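/- Let $\mathbb T^2=\mathbb R^2/\mathbb Z^2$, and let $F$ be the Green's function of the torus, that is, $F$ solves $\Delta F=2\pi(\delta_0-1)$ in the sense of distributions on $\mathbb T^2$ (and is understood as the representative that is a classical function away from $0$), normalized by $\lim_{x\to0}(F(x)-\log|x|)=0$. Let $a_1,\dots,a_m\in\mathbb T^2$ be distinct points, let $d_1,\dots,d_m$ be integers with $\sum_j d_j=0$, and put $\Phi(x)=\sum_{j=1}^m d_jF(x-a_j)$. For a scalar function $f$ write $\nabla\times f=(f_{x_2},-f_{x_1})$; for $u$ with values in $\mathbb R^2\cong\mathbb C$ write $j^k(u)=u\times u_{x_k}=u^1u^2_{x_k}-u^2u^1_{x_k}$, $k=1,2$; let $\mathbb J=\begin{pmatrix}0&1\\-1&0\end{pmatrix}$, and sum over repeated indices. A canonical harmonic map with singularities of degrees $d_1,\dots,d_m$ at $a_1,\dots,a_m$ is a map $H\in C^\infty_{\mathrm{loc}}(\mathbb T^2\setminus\{a_1,\dots,a_m\};S^1)\cap W^{1,1}(\mathbb T^2;S^1)$ with $j(H)=-\nabla\times\Phi$ on $\mathbb T^2\setminus\{a_1,\dots,a_m\}$.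 Lemma. Suppose that $\eta\in C^2(\mathbb T^2)$ is real-valued and, for some $i$, $\operatorname{supp}(\eta)\cap\{a_1,\dots,a_m\}=\{a_i\}$ and $D^2\eta\equiv0$ in a neighborhood of $a_i$. If $H$ is a canonical harmonic map with singularities of degrees $d_1,\dots,d_m$ at $a_1,\dots,a_m$, then the following integrand is integrable and $$\int_{\mathbb T^2}\eta_{x_jx_l}\,\mathbb J_{jk}\,j^k(H)\,j^l(H)\,dx=d_i\,D\eta(a_i)\cdot\Big(2\pi\sum_{j\ne i}d_j\,\nabla\times F(a_i-a_j)\Big).$$ The same holds, whether or not such a map $H$ exists for the given points and degrees, with $j(H)$ replaced by the vector field $-\nabla\times\Phi$. -/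

import Mathlib

open scoped ContDiff Topology
open MeasureTheory Filter

noncomputable section

namespace TorusVortex

/-- The flat unit torus `ℝ² / ℤ²`; `volume` on it is Haar measure of total mass one. -/
abbrev T2 : Type := UnitAddTorus (Fin 2)

/-- The covering map `ℝ² → ℝ² / ℤ²`. -/
def proj (y : EuclideanSpace ℝ (Fin 2)) : T2 := fun k => ((y k : ℝ) : UnitAddCircle)

/-- `C^n` functions on the torus: the periodic lift to the plane is `C^n`. -/
def TorusContDiff (n : ℕ∞) {E : Type*} [NormedAddCommGroup E] [NormedSpace ℝ E]
    (f : T2 → E) : Prop :=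
  ContDiff ℝ n (fun y => f (proj y))

/-- `C^n` functions on a subset of the torus (used for open subsets). -/
def TorusContDiffOn (n : ℕ∞) {E : Type*} [NormedAddCommGroup E] [NormedSpace ℝ E]
    (f : T2 → E) (U : Set T2) : Prop :=
  ContDiffOn ℝ n (fun y => f (proj y)) (proj ⁻¹' U)

/-- The partial derivative `f_{x_k}` of a function on the torus. -/
def pd {E : Type*} [NormedAddCommGroup E] [NormedSpace ℝ E]
    (k : Fin 2) (f : T2 → E) (x : T2) : E :=
  deriv (fun t : ℝ => f (x + Pi.single k (t : UnitAddCircle))) 0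

/-- The Laplacian on the torus. -/
def lap (f : T2 → ℝ) (x : T2) : ℝ := ∑ k, pd k (pd k f) x

/-- The gradient `D f = (f_{x_1}, f_{x_2})`. -/
def grad (f : T2 → ℝ) (x : T2) : Fin 2 → ℝ := fun k => pd k f x

/-- The curl of a scalar function, `∇ × f = (f_{x_2}, - f_{x_1})`. -/
def curl (f : T2 → ℝ) (x : T2) : Fin 2 → ℝ := ![pd 1 f x, - pd 0 f x]

/-- The matrix `𝕁`. -/
def J : Matrix (Fin 2) (Fin 2) ℝ := !![0, 1; -1, 0]

/-- The cross product `u × v = u¹ v² - u² v¹` on `ℝ² = ℂ`. -/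
def cross (u v : ℂ) : ℝ := u.re * v.im - u.im * v.re

/-- The current `j(u) = (u × u_{x_1}, u × u_{x_2})`. -/
def current (u : T2 → ℂ) (x : T2) : Fin 2 → ℝ := fun k => cross (u x) (pd k u x)

/-- `g` is the weak partial derivative of `f` in direction `k`. -/
def HasWeakPd (k : Fin 2) (f g : T2 → ℂ) : Prop :=
  ∀ φ : T2 → ℝ, TorusContDiff ⊤ φ → ∫ x, pd k φ x • f x = - ∫ x, φ x • g x

/-- The Sobolev space `W^{1,1}` of the torus. -/
def MemW11 (f : T2 → ℂ) : Prop :=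
  Integrable f ∧ ∀ k, ∃ g : T2 → ℂ, Integrable g ∧ HasWeakPd k f g

/-- `F` is the Green's function of the torus: `Δ F = 2π (δ₀ - 1)` in the sense of distributions,
normalized by `F(x) - log |x| → 0` as `x → 0`. Pointwise, `F` is the representative which is a
classical function away from the pole. -/
structure IsGreen (F : T2 → ℝ) : Prop where
  contDiffOn : TorusContDiffOn 2 F {0}ᶜ
  integrable : Integrable F
  laplacian : ∀ φ : T2 → ℝ, TorusContDiff ⊤ φ →
    ∫ x, F x * lap φ x = 2 * Real.pi * (φ 0 - ∫ x, φ x)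
  normalized : Tendsto (fun y : EuclideanSpace ℝ (Fin 2) => F (proj y) - Real.log ‖y‖)
    (𝓝[≠] 0) (𝓝 0)

/-- The potential `Φ(x) = ∑ i, d_i F(x - a_i)`. -/
def potential (F : T2 → ℝ) {m : ℕ} (a : Fin m → T2) (d : Fin m → ℤ) (x : T2) : ℝ :=
  ∑ i, (d i : ℝ) * F (x - a i)

/-- `H` is a canonical harmonic map with singularities of degrees `d` at the points `a`:
a map into the unit circle, smooth away from the points `a`, in `W^{1,1}`, and satisfying
`j(H) = - ∇ × Φ`. -/
structure IsCanonicalHarmonicMap (F : T2 → ℝ) {m : ℕ} (a : Fin m → T2) (d : Fin m → ℤ)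
    (H : T2 → ℂ) : Prop where
  norm_eq_one : ∀ x ∉ Set.range a, ‖H x‖ = 1
  contDiffOn : TorusContDiffOn ⊤ H (Set.range a)ᶜ
  memW11 : MemW11 H
  current_eq : ∀ x ∉ Set.range a, current H x = - curl (potential F a d) x

/-- The integrand `η_{x_j x_l} 𝕁_{jk} v^k v^l`, summed over repeated indices. -/
def integrand (η : T2 → ℝ) (v : T2 → Fin 2 → ℝ) (x : T2) : ℝ :=
  ∑ j, ∑ k, ∑ l, pd l (pd j η) x * J j k * v x k * v x l

end TorusVortex

end

open TorusVortex

/-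
With `h = Φ_{x_1} - i Φ_{x_2}` and `∂̄ = ∂_{x_1} + i ∂_{x_2}`, the integrand for the field `-∇ × Φ`
is `Im (∂̄∂̄η · h ^ 2) / 2`. The degrees sum to zero, so `Φ` is harmonic and `h` holomorphic away
from the poles, and `∂̄η` is constant near each pole. Integrating by parts, the integral of
`∂̄∂̄η · h ^ 2` is `-2π` times the sum of the values `∂̄η (a_i)` weighted by the residues of
`h ^ 2`. Near `a_i` one has `h = d_i / z + S_i + o(1)`, where `S_i` is the complex gradient at
`a_i` of the potential of the other poles, so the residue is `2 d_i S_i`. Here the expansion of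
`∇F` at the origin has no constant term because `F` is even.
-/

noncomputable section

namespace TorusVortex

/-- The covering map of the torus with the plane viewed as `ℂ`, which makes circle integrals and
complex differentiability available for lifts. -/
def cproj (z : ℂ) : T2 := fun k => ((![z.re, z.im] k : ℝ) : UnitAddCircle)

/-- The lift of a function on the torus to the plane, with base point `x` over the origin. -/
def lift {E : Type*} (x : T2) (f : T2 → E) (z : ℂ) : E := f (x + cproj z)

/-- The coordinate directions of the plane, as complex numbers. -/
def dir : Fin 2 → ℂ := ![1, Complex.I]

section Covering

lemma cproj_add (z w : ℂ) : cproj (z + w) = cproj z + cproj w := by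
  ext k; fin_cases k <;> simp [cproj]

@[simp] lemma cproj_zero : cproj 0 = 0 := by
  ext k; fin_cases k <;> simp [cproj]

lemma cproj_neg (z : ℂ) : cproj (-z) = -cproj z := by
  ext k; fin_cases k <;> simp [cproj]

lemma cproj_mul_dir (t : ℝ) (k : Fin 2) :
    cproj (t * dir k) = Pi.single k (t : UnitAddCircle) := by
  ext j; fin_cases k <;> fin_cases j <;> simp [cproj, dir]

lemma cproj_eq_proj (z : ℂ) : cproj z = proj (Complex.orthonormalBasisOneI.repr z) := by
  ext k; fin_cases k <;> simp [cproj, proj, Complex.orthonormalBasisOneI_repr_apply]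

lemma proj_eq_cproj (y : EuclideanSpace ℝ (Fin 2)) :
    proj y = cproj (Complex.orthonormalBasisOneI.repr.symm y) := by
  rw [cproj_eq_proj, LinearIsometryEquiv.apply_symm_apply]

@[fun_prop] lemma continuous_cproj : Continuous cproj := by
  refine continuous_pi fun k => (AddCircle.continuous_mk' 1).comp ?_
  fin_cases k
  exacts [Complex.continuous_re, Complex.continuous_im]

lemma continuous_proj : Continuous proj := by
  simp_rw [funext proj_eq_cproj]
  fun_prop

lemma isOpenMap_cproj : IsOpenMap cproj := by
  have h : cproj = (Pi.map fun _ : Fin 2 => ((↑) : ℝ → UnitAddCircle)) ∘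
      Complex.equivRealProdCLM.toHomeomorph.trans (Homeomorph.finTwoArrow (X := ℝ)).symm := by
    ext z k; fin_cases k <;> rfl
  rw [h]
  exact (IsOpenMap.piMap (fun _ => QuotientAddGroup.isOpenMap_coe) (by simp)).comp
    (Homeomorph.isOpenMap _)

lemma cproj_surjective : Function.Surjective cproj := by
  intro x
  obtain ⟨s, hs⟩ := QuotientAddGroup.mk_surjective (x 0)
  obtain ⟨t, ht⟩ := QuotientAddGroup.mk_surjective (x 1)
  refine ⟨⟨s, t⟩, ?_⟩
  ext k
  fin_cases k
  exacts [hs, ht]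

lemma exists_eq_add_cproj (x y : T2) : ∃ z, y = x + cproj z := by
  obtain ⟨z, hz⟩ := cproj_surjective (y - x)
  exact ⟨z, by simp [hz]⟩

lemma map_nhds_add_cproj (x : T2) : map (fun z => x + cproj z) (𝓝 0) = 𝓝 x := by
  simpa using ((isOpenMap_add_left x).comp isOpenMap_cproj).map_nhds_eq
    (f := fun z => x + cproj z) (x := 0) (by fun_prop)

lemma tendsto_add_cproj (x : T2) : Tendsto (fun z => x + cproj z) (𝓝 0) (𝓝 x) :=
  (map_nhds_add_cproj x).le

variable {E : Type*} {x : T2} {f g : T2 → E}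

lemma lift_zero : lift x f 0 = f x := by simp [lift]

lemma lift_add_cproj (w : ℂ) : lift (x + cproj w) f = fun z => lift x f (w + z) := by
  ext z; simp only [lift, cproj_add, add_assoc]

lemma lift_comp_sub (c : T2) : lift x (fun y => f (y - c)) = lift (x - c) f := by
  ext z; simp only [lift, add_sub_right_comm]

lemma lift_comp_neg : lift x (fun y => f (-y)) = fun z => lift (-x) f (-z) := by
  ext z; simp only [lift, cproj_neg, neg_add]

lemma lift_zero_eq_comp_proj :
    lift 0 f = (fun y => f (proj y)) ∘ Complex.orthonormalBasisOneI.repr := by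
  ext z; simp [lift, cproj_eq_proj]

lemma lift_eventuallyEq (h : f =ᶠ[𝓝 x] g) : lift x f =ᶠ[𝓝 0] lift x g :=
  (tendsto_add_cproj x).eventually h

lemma continuousAt_lift_iff [TopologicalSpace E] :
    ContinuousAt (lift x f) 0 ↔ ContinuousAt f x := by
  rw [ContinuousAt, lift_zero, ContinuousAt, ← map_nhds_add_cproj x, tendsto_map'_iff]
  rfl

end Covering

section SmoothAt

variable {E : Type*} [NormedAddCommGroup E] [NormedSpace ℝ E]

/-- Pointwise `C^n` regularity of a function on the torus, for use with functions that have
singularities. -/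
def SmoothAt (n : WithTop ℕ∞) (f : T2 → E) (x : T2) : Prop := ContDiffAt ℝ n (lift x f) 0

variable {m n : WithTop ℕ∞} {f g : T2 → E} {x : T2}

lemma smoothAt_add_cproj_iff (w : ℂ) :
    SmoothAt n f (x + cproj w) ↔ ContDiffAt ℝ n (lift x f) w := by
  rw [SmoothAt, lift_add_cproj]
  constructor <;> intro h
  · simpa [Function.comp_def] using ContDiffAt.comp w (g := fun z => lift x f (w + z))
      (f := fun z => z - w) (by simpa using h) (by fun_prop)
  · exact ContDiffAt.comp (0 : ℂ) (g := lift x f) (by simpa using h) (by fun_prop)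

lemma TorusContDiff.smoothAt {n : ℕ∞} (h : TorusContDiff n f) (x : T2) : SmoothAt n f x := by
  obtain ⟨w, rfl⟩ := exists_eq_add_cproj 0 x
  rw [smoothAt_add_cproj_iff, lift_zero_eq_comp_proj]
  exact (ContDiff.comp h (LinearIsometryEquiv.contDiff _)).contDiffAt

lemma torusContDiff_of_smoothAt {n : ℕ∞} (h : ∀ x, SmoothAt n f x) : TorusContDiff n f := by
  have hlift : ContDiff ℝ n (lift 0 f) :=
    contDiff_iff_contDiffAt.2 fun w => (smoothAt_add_cproj_iff w).1 (h _)
  rw [lift_zero_eq_comp_proj] at hlift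
  simpa only [TorusContDiff, Function.comp_def, LinearIsometryEquiv.apply_symm_apply] using
    hlift.comp (LinearIsometryEquiv.contDiff Complex.orthonormalBasisOneI.repr.symm)

lemma TorusContDiffOn.smoothAt {n : ℕ∞} {U : Set T2} (h : TorusContDiffOn n f U) (hU : U ∈ 𝓝 x) :
    SmoothAt n f x := by
  obtain ⟨w, rfl⟩ := exists_eq_add_cproj 0 x
  rw [smoothAt_add_cproj_iff, lift_zero_eq_comp_proj]
  refine ContDiffAt.comp w (ContDiffOn.contDiffAt h ?_) (LinearIsometryEquiv.contDiff _).contDiffAt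
  exact continuous_proj.continuousAt.preimage_mem_nhds (by simpa [← cproj_eq_proj] using hU)

lemma SmoothAt.congr (hf : SmoothAt n f x) (h : g =ᶠ[𝓝 x] f) : SmoothAt n g x :=
  ContDiffAt.congr_of_eventuallyEq hf (lift_eventuallyEq h)

lemma SmoothAt.of_le (hf : SmoothAt n f x) (h : m ≤ n) : SmoothAt m f x :=
  ContDiffAt.of_le hf h

lemma SmoothAt.differentiableAt (hf : SmoothAt 1 f x) : DifferentiableAt ℝ (lift x f) 0 :=
  ContDiffAt.differentiableAt hf one_ne_zero

lemma SmoothAt.continuousAt (hf : SmoothAt n f x) : ContinuousAt f x :=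
  continuousAt_lift_iff.1 (ContDiffAt.continuousAt hf)

lemma continuous_of_smoothAt (hf : ∀ x, SmoothAt n f x) : Continuous f :=
  continuous_iff_continuousAt.2 fun x => (hf x).continuousAt

lemma smoothAt_const (c : E) : SmoothAt n (fun _ => c) x := contDiffAt_const

lemma SmoothAt.add (hf : SmoothAt n f x) (hg : SmoothAt n g x) :
    SmoothAt n (fun y => f y + g y) x := ContDiffAt.add hf hg

lemma SmoothAt.sub (hf : SmoothAt n f x) (hg : SmoothAt n g x) :
    SmoothAt n (fun y => f y - g y) x := ContDiffAt.sub hf hg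

lemma SmoothAt.mul {A : Type*} [NormedRing A] [NormedAlgebra ℝ A] {f g : T2 → A}
    (hf : SmoothAt n f x) (hg : SmoothAt n g x) :
    SmoothAt n (fun y => f y * g y) x := ContDiffAt.mul hf hg

lemma SmoothAt.sum {ι : Type*} {s : Finset ι} {f : ι → T2 → E}
    (hf : ∀ i ∈ s, SmoothAt n (f i) x) : SmoothAt n (fun y => ∑ i ∈ s, f i y) x :=
  ContDiffAt.sum (f := fun i => lift x (f i)) hf

lemma SmoothAt.ofReal {f : T2 → ℝ} (hf : SmoothAt n f x) :
    SmoothAt n (fun y => (f y : ℂ)) x :=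
  Complex.ofRealCLM.contDiff.contDiffAt.comp (0 : ℂ) hf

lemma SmoothAt.comp_sub {c : T2} (hf : SmoothAt n f (x - c)) :
    SmoothAt n (fun y => f (y - c)) x := by
  rwa [SmoothAt, lift_comp_sub]

lemma SmoothAt.comp_neg (hf : SmoothAt n f (-x)) : SmoothAt n (fun y => f (-y)) x := by
  rw [SmoothAt, lift_comp_neg]
  exact ContDiffAt.comp (0 : ℂ) (g := lift (-x) f) (by simpa [SmoothAt] using hf) (by fun_prop)

end SmoothAt

section PartialDerivatives

variable {E : Type*} [NormedAddCommGroup E] [NormedSpace ℝ E]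
  {A : Type*} [NormedRing A] [NormedAlgebra ℝ A]
  {m n : WithTop ℕ∞} {f g : T2 → E} {x : T2}

lemma SmoothAt.hasDerivAt (hf : SmoothAt 1 f x) (k : Fin 2) :
    HasDerivAt (fun t : ℝ => f (x + Pi.single k (t : UnitAddCircle)))
      (fderiv ℝ (lift x f) 0 (dir k)) 0 := by
  have hline : HasDerivAt (fun t : ℝ => (t : ℂ) * dir k) (dir k) 0 := by
    simpa using (Complex.ofRealCLM.hasDerivAt (x := (0 : ℝ))).mul_const (dir k)
  have := HasFDerivAt.comp_hasDerivAt (0 : ℝ) (by simpa using hf.differentiableAt.hasFDerivAt) hline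
  simpa [Function.comp_def, lift, cproj_mul_dir] using this

lemma SmoothAt.pd_eq_fderiv (hf : SmoothAt 1 f x) (k : Fin 2) :
    pd k f x = fderiv ℝ (lift x f) 0 (dir k) := (hf.hasDerivAt k).deriv

lemma pd_add_cproj_eq_fderiv {w : ℂ} (hf : SmoothAt 1 f (x + cproj w)) (k : Fin 2) :
    pd k f (x + cproj w) = fderiv ℝ (lift x f) w (dir k) := by
  rw [hf.pd_eq_fderiv, lift_add_cproj, fderiv_comp_add_left, add_zero]

lemma SmoothAt.hasDerivAt_pd (hf : SmoothAt 1 f x) (k : Fin 2) :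
    HasDerivAt (fun t : ℝ => f (x + Pi.single k (t : UnitAddCircle))) (pd k f x) 0 := by
  simpa only [hf.pd_eq_fderiv k] using hf.hasDerivAt k

lemma SmoothAt.eventually_smoothAt (hf : SmoothAt 1 f x) : ∀ᶠ y in 𝓝 x, SmoothAt 1 f y := by
  rw [← map_nhds_add_cproj x, eventually_map]
  filter_upwards [ContDiffAt.eventually hf (by simp)] with w hw
  exact (smoothAt_add_cproj_iff w).2 hw

lemma SmoothAt.lift_pd_eventuallyEq (hf : SmoothAt 1 f x) (k : Fin 2) :
    lift x (pd k f) =ᶠ[𝓝 0] fun w => fderiv ℝ (lift x f) w (dir k) := by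
  filter_upwards [(tendsto_add_cproj x).eventually hf.eventually_smoothAt] with w hw
  exact pd_add_cproj_eq_fderiv hw k

lemma SmoothAt.smoothAt_pd (hf : SmoothAt n f x) (hm : m + 1 ≤ n) (k : Fin 2) :
    SmoothAt m (pd k f) x := by
  have hf1 : SmoothAt 1 f x := hf.of_le (le_add_self.trans hm)
  exact ((ContDiffAt.fderiv_right (m := m) hf hm).clm_apply contDiffAt_const).congr_of_eventuallyEq
    (hf1.lift_pd_eventuallyEq k)

lemma pd_congr (k : Fin 2) (h : f =ᶠ[𝓝 x] g) : pd k f x = pd k g x := by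
  have hline : Tendsto (fun t : ℝ => x + Pi.single k (t : UnitAddCircle)) (𝓝 0) (𝓝 x) := by
    have : Continuous fun t : ℝ => x + cproj (t * dir k) := by fun_prop
    simpa [cproj_mul_dir] using this.tendsto 0
  exact EventuallyEq.deriv_eq (hline.eventually h)

lemma pd_eq_zero_of_eventuallyEq_const (k : Fin 2) {c : E} (h : f =ᶠ[𝓝 x] fun _ => c) :
    pd k f x = 0 := by
  rw [pd_congr k h, pd, deriv_const]

lemma pd_add (hf : SmoothAt 1 f x) (hg : SmoothAt 1 g x) (k : Fin 2) :
    pd k (fun y => f y + g y) x = pd k f x + pd k g x :=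
  ((hf.hasDerivAt_pd k).add (hg.hasDerivAt_pd k)).deriv

lemma pd_sub (hf : SmoothAt 1 f x) (hg : SmoothAt 1 g x) (k : Fin 2) :
    pd k (fun y => f y - g y) x = pd k f x - pd k g x :=
  ((hf.hasDerivAt_pd k).sub (hg.hasDerivAt_pd k)).deriv

lemma pd_sum {ι : Type*} {s : Finset ι} {f : ι → T2 → E}
    (hf : ∀ i ∈ s, SmoothAt 1 (f i) x) (k : Fin 2) :
    pd k (fun y => ∑ i ∈ s, f i y) x = ∑ i ∈ s, pd k (f i) x :=
  (HasDerivAt.fun_sum fun i hi => (hf i hi).hasDerivAt_pd k).deriv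

lemma pd_mul {f g : T2 → A} (hf : SmoothAt 1 f x) (hg : SmoothAt 1 g x) (k : Fin 2) :
    pd k (fun y => f y * g y) x = pd k f x * g x + f x * pd k g x := by
  have := ((hf.hasDerivAt_pd k).fun_mul (hg.hasDerivAt_pd k)).deriv
  simp only [AddCircle.coe_zero, Pi.single_zero, add_zero] at this
  exact this

lemma pd_const_mul {𝕜 : Type*} [NormedField 𝕜] [NormedAlgebra ℝ 𝕜] (k : Fin 2) (c : 𝕜)
    (f : T2 → 𝕜) (x : T2) : pd k (fun y => c * f y) x = c * pd k f x :=
  deriv_const_mul_field c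

lemma pd_ofReal {f : T2 → ℝ} (hf : SmoothAt 1 f x) (k : Fin 2) :
    pd k (fun y => (f y : ℂ)) x = (pd k f x : ℝ) :=
  (hf.hasDerivAt_pd k).ofReal_comp.deriv

lemma pd_comp_sub (k : Fin 2) (f : T2 → E) (c x : T2) :
    pd k (fun y => f (y - c)) x = pd k f (x - c) := by
  simp only [pd, add_sub_right_comm]

lemma pd_neg (k : Fin 2) (f : T2 → E) (x : T2) : pd k (fun y => -f y) x = -pd k f x :=
  deriv.fun_neg

lemma pd_comp_neg (k : Fin 2) (f : T2 → E) (x : T2) :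
    pd k (fun y => f (-y)) x = -pd k f (-x) := by
  have := deriv_comp_neg (fun t : ℝ => f (-x + Pi.single k (t : UnitAddCircle))) 0
  simpa [pd, AddCircle.coe_neg, Pi.single_neg, add_comm] using this

lemma pd_pd_eq_fderiv_fderiv (hf : SmoothAt 2 f x) (k l : Fin 2) :
    pd k (pd l f) x = fderiv ℝ (fderiv ℝ (lift x f)) 0 (dir k) (dir l) := by
  have hf1 : SmoothAt 1 f x := hf.of_le one_le_two
  have hd : DifferentiableAt ℝ (fderiv ℝ (lift x f)) 0 :=
    (ContDiffAt.fderiv_right (m := 1) hf (by norm_num)).differentiableAt one_ne_zero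
  rw [(hf.smoothAt_pd (m := 1) (by norm_num) l).pd_eq_fderiv k,
    (hf1.lift_pd_eventuallyEq l).fderiv_eq,
    fderiv_clm_apply hd (differentiableAt_const _)]
  simp

lemma pd_comm (hf : SmoothAt 2 f x) (k l : Fin 2) : pd k (pd l f) x = pd l (pd k f) x := by
  have hsymm : IsSymmSndFDerivAt ℝ (lift x f) 0 := ContDiffAt.isSymmSndFDerivAt hf (by simp)
  rw [pd_pd_eq_fderiv_fderiv hf, pd_pd_eq_fderiv_fderiv hf, hsymm.eq]

end PartialDerivatives

section Laplacian

lemma lap_comp_neg (f : T2 → ℝ) (x : T2) : lap (fun y => f (-y)) x = lap f (-x) := by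
  simp only [lap, funext (pd_comp_neg _ f), pd_neg, pd_comp_neg, neg_neg]

lemma lap_sub {f g : T2 → ℝ} {x : T2} (hf : SmoothAt 2 f x) (hg : SmoothAt 2 g x) :
    lap (fun y => f y - g y) x = lap f x - lap g x := by
  have hpd : ∀ k, pd k (fun y => f y - g y) =ᶠ[𝓝 x] fun y => pd k f y - pd k g y := fun k => by
    filter_upwards [(hf.of_le one_le_two).eventually_smoothAt,
      (hg.of_le one_le_two).eventually_smoothAt] with y hfy hgy using pd_sub hfy hgy k
  simp only [lap, pd_congr _ (hpd _), pd_sub (hf.smoothAt_pd (by norm_num) _)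
    (hg.smoothAt_pd (by norm_num) _), Finset.sum_sub_distrib]

end Laplacian

section IntegrationByParts

lemma integrable_of_continuous {E : Type*} [NormedAddCommGroup E] {f : T2 → E}
    (hf : Continuous f) : Integrable f :=
  hf.integrable_of_hasCompactSupport (HasCompactSupport.of_compactSpace f)

lemma continuous_mul_of_tsupport {A : Type*} [NormedRing A] {g h : T2 → A} (hg : Continuous g)
    (hh : ∀ x ∈ tsupport g, ContinuousAt h x) : Continuous fun x => g x * h x :=
  continuous_of_tsupport fun x hx => hg.continuousAt.mul (hh x (tsupport_mul_subset_left hx))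

variable {E : Type*} [NormedAddCommGroup E] [NormedSpace ℝ E]
  {A : Type*} [NormedRing A] [NormedAlgebra ℝ A]

lemma hasDerivAt_translate {g : T2 → E} (hg : ∀ x, SmoothAt 1 g x) (k : Fin 2) (x : T2) (t : ℝ) :
    HasDerivAt (fun s : ℝ => g (x + Pi.single k (s : UnitAddCircle)))
      (pd k g (x + Pi.single k (t : UnitAddCircle))) t := by
  have h := (hg (x + Pi.single k (t : UnitAddCircle))).hasDerivAt_pd k
  rw [← sub_self t] at h
  simpa only [add_assoc, ← Pi.single_add, ← AddCircle.coe_add, add_sub_cancel] using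
    h.comp_sub_const t t

/-- Differentiate `∫ g (x + t e_k) dx`, which by translation invariance does not depend on `t`. -/
lemma integral_pd_eq_zero {g : T2 → E} (hg : ∀ x, SmoothAt 1 g x) (k : Fin 2) :
    ∫ x, pd k g x = 0 := by
  have hc : Continuous g := continuous_of_smoothAt hg
  have hpc : Continuous (pd k g) :=
    continuous_of_smoothAt fun x => (hg x).smoothAt_pd (m := 0) (by simp) k
  obtain ⟨C, hC⟩ := (isCompact_univ (X := T2)).exists_bound_of_continuousOn hpc.continuousOn
  have hderiv := (hasDerivAt_integral_of_dominated_loc_of_deriv_le (μ := (volume : Measure T2))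
    (F := fun (t : ℝ) x => g (x + Pi.single k (t : UnitAddCircle)))
    (F' := fun (t : ℝ) x => pd k g (x + Pi.single k (t : UnitAddCircle)))
    (x₀ := (0 : ℝ)) (s := Set.univ) (bound := fun _ => C) univ_mem
    (Eventually.of_forall fun t => (hc.comp (by fun_prop)).aestronglyMeasurable)
    (integrable_of_continuous (hc.comp (by fun_prop)))
    (hpc.comp (by fun_prop)).aestronglyMeasurable
    (Eventually.of_forall fun x t _ => hC _ trivial) (integrable_const C)
    (Eventually.of_forall fun x t _ => hasDerivAt_translate hg k x t)).2
  simp only [integral_add_right_eq_self, AddCircle.coe_zero, Pi.single_zero, add_zero] at hderiv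
  exact hderiv.unique (hasDerivAt_const 0 _)

lemma tsupport_pd_subset (k : Fin 2) (g : T2 → E) : tsupport (pd k g) ⊆ tsupport g := by
  refine fun x => not_imp_not.1 fun hx => ?_
  rw [notMem_tsupport_iff_eventuallyEq] at hx ⊢
  filter_upwards [hx.eventuallyEq_nhds] with y hy
  exact pd_eq_zero_of_eventuallyEq_const k hy

lemma smoothAt_mul_of_tsupport {n : WithTop ℕ∞} {g h : T2 → A} {x : T2} (hg : SmoothAt n g x)
    (hh : x ∈ tsupport g → SmoothAt n h x) : SmoothAt n (fun y => g y * h y) x := by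
  by_cases hx : x ∈ tsupport g
  · exact hg.mul (hh hx)
  · rw [notMem_tsupport_iff_eventuallyEq] at hx
    refine (smoothAt_const 0).congr ?_
    filter_upwards [hx] with y hy using by simp [hy]

lemma pd_mul_of_tsupport {g h : T2 → A} {x : T2} (hg : SmoothAt 1 g x)
    (hh : x ∈ tsupport g → SmoothAt 1 h x) (k : Fin 2) :
    pd k (fun y => g y * h y) x = pd k g x * h x + g x * pd k h x := by
  by_cases hx : x ∈ tsupport g
  · exact pd_mul hg (hh hx) k
  · have hzero := notMem_tsupport_iff_eventuallyEq.1 hx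
    rw [pd_eq_zero_of_eventuallyEq_const k hzero, hzero.self_of_nhds,
      pd_eq_zero_of_eventuallyEq_const (c := 0) k (hzero.mono fun y hy => by simp [hy])]
    simp

lemma integrable_pd_mul {g h : T2 → A} (hg : ∀ x, SmoothAt 1 g x)
    (hh : ∀ x ∈ tsupport g, ContinuousAt h x) (k : Fin 2) :
    Integrable fun x => pd k g x * h x :=
  integrable_of_continuous <| continuous_mul_of_tsupport
    (continuous_of_smoothAt fun x => (hg x).smoothAt_pd (m := 0) (by simp) k)
    fun x hx => hh x (tsupport_pd_subset k g hx)

lemma integrable_mul_pd {g h : T2 → A} (hg : Continuous g)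
    (hh : ∀ x ∈ tsupport g, SmoothAt 1 h x) (k : Fin 2) :
    Integrable fun x => g x * pd k h x :=
  integrable_of_continuous <| continuous_mul_of_tsupport hg
    fun x hx => ((hh x hx).smoothAt_pd (m := 0) (by simp) k).continuousAt

lemma integral_pd_mul {g h : T2 → A} (hg : ∀ x, SmoothAt 1 g x)
    (hh : ∀ x ∈ tsupport g, SmoothAt 1 h x) (k : Fin 2) :
    ∫ x, pd k g x * h x = -∫ x, g x * pd k h x := by
  rw [eq_neg_iff_add_eq_zero,
    ← integral_add (integrable_pd_mul hg (fun x hx => (hh x hx).continuousAt) k)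
      (integrable_mul_pd (continuous_of_smoothAt hg) hh k),
    ← integral_pd_eq_zero (fun x => smoothAt_mul_of_tsupport (hg x) (hh x)) k]
  simp only [fun x => pd_mul_of_tsupport (hg x) (hh x) k]

lemma integral_mul_lap {φ F : T2 → ℝ} (hφ : ∀ x, SmoothAt 2 φ x)
    (hF : ∀ x ∈ tsupport φ, SmoothAt 2 F x) :
    ∫ x, F x * lap φ x = ∫ x, φ x * lap F x := by
  have hφ' : ∀ k x, SmoothAt 1 (pd k φ) x := fun k x => (hφ x).smoothAt_pd (by norm_num) k
  have hF' : ∀ k, ∀ x ∈ tsupport φ, SmoothAt 1 (pd k F) x :=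
    fun k x hx => (hF x hx).smoothAt_pd (by norm_num) k
  have hsupp : ∀ k, tsupport (pd k φ) ⊆ tsupport φ := fun k => tsupport_pd_subset k φ
  have hparts : ∀ k, ∫ x, pd k (pd k φ) x * F x = ∫ x, φ x * pd k (pd k F) x := fun k => by
    rw [integral_pd_mul (hφ' k) (fun x hx => (hF x (hsupp k hx)).of_le one_le_two),
      integral_pd_mul (fun x => (hφ x).of_le one_le_two) (hF' k), neg_neg]
  simp only [lap, mul_comm (F _), Finset.mul_sum, Finset.sum_mul]
  rw [integral_finsetSum _ fun k _ => integrable_pd_mul (hφ' k)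
      (fun x hx => (hF x (hsupp k hx)).continuousAt) k,
    integral_finsetSum _ fun k _ => integrable_mul_pd (continuous_of_smoothAt hφ) (hF' k) k]
  exact Finset.sum_congr rfl fun k _ => hparts k

end IntegrationByParts

/-- The complex gradient `u_x - i u_y` of a real function, i.e. `2 ∂u/∂z`. -/
def tgrad (u : T2 → ℝ) (x : T2) : ℂ := pd 0 u x - Complex.I * pd 1 u x

/-- The Cauchy–Riemann operator `g_x + i g_y`, i.e. `2 ∂g/∂z̄`. -/
def dbar (g : T2 → ℂ) (x : T2) : ℂ := pd 0 g x + Complex.I * pd 1 g x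

section CauchyRiemann

variable {m n : WithTop ℕ∞} {u : T2 → ℝ} {g h : T2 → ℂ} {x : T2}

lemma SmoothAt.smoothAt_tgrad (hu : SmoothAt n u x) (hm : m + 1 ≤ n) : SmoothAt m (tgrad u) x :=
  (hu.smoothAt_pd hm 0).ofReal.sub ((smoothAt_const _).mul (hu.smoothAt_pd hm 1).ofReal)

lemma SmoothAt.smoothAt_dbar (hg : SmoothAt n g x) (hm : m + 1 ≤ n) : SmoothAt m (dbar g) x :=
  (hg.smoothAt_pd hm 0).add ((smoothAt_const _).mul (hg.smoothAt_pd hm 1))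

lemma dbar_congr (hgh : g =ᶠ[𝓝 x] h) : dbar g x = dbar h x := by
  rw [dbar, dbar, pd_congr 0 hgh, pd_congr 1 hgh]

lemma dbar_eq_zero_of_eventuallyEq_const {c : ℂ} (hg : g =ᶠ[𝓝 x] fun _ => c) : dbar g x = 0 := by
  simp [dbar, pd_eq_zero_of_eventuallyEq_const _ hg]

lemma dbar_add (hg : SmoothAt 1 g x) (hh : SmoothAt 1 h x) :
    dbar (fun y => g y + h y) x = dbar g x + dbar h x := by
  simp only [dbar, pd_add hg hh]
  ring

lemma dbar_sub (hg : SmoothAt 1 g x) (hh : SmoothAt 1 h x) :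
    dbar (fun y => g y - h y) x = dbar g x - dbar h x := by
  simp only [dbar, pd_sub hg hh]
  ring

lemma dbar_sum {ι : Type*} {s : Finset ι} {g : ι → T2 → ℂ} (hg : ∀ i ∈ s, SmoothAt 1 (g i) x) :
    dbar (fun y => ∑ i ∈ s, g i y) x = ∑ i ∈ s, dbar (g i) x := by
  simp only [dbar, pd_sum hg, Finset.mul_sum, Finset.sum_add_distrib]

lemma dbar_const_mul (c : ℂ) (g : T2 → ℂ) (x : T2) :
    dbar (fun y => c * g y) x = c * dbar g x := by
  simp only [dbar, pd_const_mul]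
  ring

lemma dbar_sq_eq_zero (hg : SmoothAt 1 g x) (h : dbar g x = 0) :
    dbar (fun y => g y ^ 2) x = 0 := by
  rw [dbar] at h
  simp only [sq, dbar, pd_mul hg hg]
  linear_combination 2 * g x * h

lemma dbar_comp_sub (g : T2 → ℂ) (c x : T2) : dbar (fun y => g (y - c)) x = dbar g (x - c) := by
  simp only [dbar, pd_comp_sub]

lemma dbar_ofReal (hu : SmoothAt 1 u x) :
    dbar (fun y => (u y : ℂ)) x = pd 0 u x + Complex.I * pd 1 u x := by
  rw [dbar, pd_ofReal hu, pd_ofReal hu]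

lemma dbar_tgrad (hu : SmoothAt 2 u x) : dbar (tgrad u) x = lap u x := by
  have hpd : ∀ k, SmoothAt 1 (pd k u) x := fun k => hu.smoothAt_pd (by norm_num) k
  have hpd' : ∀ k, pd k (tgrad u) x = pd k (pd 0 u) x - Complex.I * pd k (pd 1 u) x := fun k => by
    have := pd_sub (hpd 0).ofReal ((smoothAt_const Complex.I).mul (hpd 1).ofReal) k
    rwa [pd_const_mul, pd_ofReal (hpd 0), pd_ofReal (hpd 1)] at this
  rw [dbar, hpd', hpd', pd_comm hu 1 0, lap, Fin.sum_univ_two]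
  push_cast
  linear_combination -((pd 1 (pd 1 u) x : ℝ) : ℂ) * Complex.I_sq

lemma differentiableAt_lift_of_dbar_eq_zero {w : ℂ} (hg : SmoothAt 1 g (x + cproj w))
    (h : dbar g (x + cproj w) = 0) : DifferentiableAt ℂ (lift x g) w := by
  rw [differentiableAt_complex_iff_differentiableAt_real]
  refine ⟨((smoothAt_add_cproj_iff w).1 hg).differentiableAt one_ne_zero, ?_⟩
  rw [dbar, pd_add_cproj_eq_fderiv hg, pd_add_cproj_eq_fderiv hg] at h
  simp only [dir, Matrix.cons_val_zero, Matrix.cons_val_one] at h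
  rw [smul_eq_mul]
  linear_combination (-Complex.I) * h + fderiv ℝ (lift x g) w Complex.I * Complex.I_sq

lemma integral_dbar_mul_eq_zero (hg : ∀ x, SmoothAt 1 g x) (hh : ∀ x ∈ tsupport g, SmoothAt 1 h x)
    (hdbar : ∀ x ∈ tsupport g, dbar h x = 0) : ∫ x, dbar g x * h x = 0 := by
  have hcont : ∀ x ∈ tsupport g, ContinuousAt h x := fun x hx => (hh x hx).continuousAt
  have hzero : ∀ x, g x * dbar h x = 0 := fun x => by
    by_cases hx : x ∈ tsupport g
    · rw [hdbar x hx, mul_zero]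
    · rw [image_eq_zero_of_notMem_tsupport hx, zero_mul]
  have hg' := continuous_of_smoothAt hg
  calc ∫ x, dbar g x * h x
      = ∫ x, (pd 0 g x * h x + Complex.I * (pd 1 g x * h x)) := by
        simp only [dbar, add_mul, mul_assoc]
    _ = -((∫ x, g x * pd 0 h x) + Complex.I * ∫ x, g x * pd 1 h x) := by
        rw [integral_add (integrable_pd_mul hg hcont 0)
          ((integrable_pd_mul hg hcont 1).const_mul _), integral_const_mul,
          integral_pd_mul hg hh, integral_pd_mul hg hh]
        ring
    _ = -∫ x, g x * dbar h x := by
        rw [← integral_const_mul, ← integral_add (integrable_mul_pd hg' hh 0)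
          ((integrable_mul_pd hg' hh 1).const_mul _)]
        simp only [dbar, mul_add, mul_left_comm]
    _ = 0 := by simp only [hzero, integral_zero, neg_zero]

end CauchyRiemann

/-- The squared flat distance to the origin; unlike the sup norm of `T2` it lifts to the smooth
function `‖z‖ ^ 2` near the origin. -/
def flatNormSq (x : T2) : ℝ := ‖x 0‖ ^ 2 + ‖x 1‖ ^ 2

section FlatNorm

@[fun_prop] lemma continuous_flatNormSq : Continuous flatNormSq := by
  unfold flatNormSq
  fun_prop

lemma flatNormSq_nonneg (x : T2) : 0 ≤ flatNormSq x := by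
  unfold flatNormSq
  positivity

lemma norm_sq_le_flatNormSq (x : T2) : ‖x‖ ^ 2 ≤ flatNormSq x := by
  have hnorm : ‖x‖ ≤ √(flatNormSq x) := by
    refine (pi_norm_le_iff_of_nonneg (Real.sqrt_nonneg _)).2 fun k => Real.le_sqrt_of_sq_le ?_
    fin_cases k <;> simp [flatNormSq]
  exact (Real.le_sqrt (norm_nonneg x) (flatNormSq_nonneg x)).1 hnorm

lemma flatNormSq_cproj {z : ℂ} (hre : |z.re| ≤ 1 / 2) (him : |z.im| ≤ 1 / 2) :
    flatNormSq (cproj z) = ‖z‖ ^ 2 := by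
  have hnorm : ∀ t : ℝ, |t| ≤ 1 / 2 → ‖(t : UnitAddCircle)‖ = |t| := fun t ht =>
    (AddCircle.norm_coe_eq_abs_iff 1 one_ne_zero).2 (by simpa using ht)
  simp only [flatNormSq, cproj, Matrix.cons_val_zero, Matrix.cons_val_one, hnorm _ hre, hnorm _ him,
    sq_abs, Complex.sq_norm, Complex.normSq_apply]
  ring

lemma flatNormSq_cproj_of_norm_le {z : ℂ} (hz : ‖z‖ ≤ 1 / 2) : flatNormSq (cproj z) = ‖z‖ ^ 2 :=
  flatNormSq_cproj ((Complex.abs_re_le_norm z).trans hz) ((Complex.abs_im_le_norm z).trans hz)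

lemma exists_cproj_eq_of_flatNormSq (x : T2) : ∃ z, cproj z = x ∧ ‖z‖ ^ 2 = flatNormSq x := by
  obtain ⟨w, rfl⟩ := cproj_surjective x
  have hround : cproj ⟨w.re - round w.re, w.im - round w.im⟩ = cproj w := by
    have hint : ∀ n : ℤ, ((n : ℝ) : UnitAddCircle) = 0 := fun n =>
      (AddCircle.coe_eq_zero_iff 1).2 ⟨n, by simp⟩
    ext k
    fin_cases k <;> simp [cproj, hint]
  exact ⟨_, hround, by rw [← hround, flatNormSq_cproj (abs_sub_round _) (abs_sub_round _)]⟩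

end FlatNorm

/-- A smooth function of the squared radius which is `1` up to `r ^ 2 / 2` and `0` beyond `r ^ 2`;
the radial profile of `cutoff`. -/
def cutoffProfile (r t : ℝ) : ℝ := Real.smoothTransition (2 - 2 * t / r ^ 2)

/-- A smooth radial cutoff on the torus (for `r < 1 / 2`): equal to `1` near `c` and supported in
the flat disc of radius `r` about `c`. -/
def cutoff (r : ℝ) (c x : T2) : ℝ := cutoffProfile r (flatNormSq (x - c))

section Cutoff

variable {r : ℝ} {c x : T2}

lemma contDiff_cutoffProfile {n : ℕ∞} : ContDiff ℝ n (cutoffProfile r) :=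
  Real.smoothTransition.contDiff.comp (by fun_prop)

lemma cutoffProfile_zero : cutoffProfile r 0 = 1 :=
  Real.smoothTransition.one_of_one_le (by norm_num)

lemma cutoffProfile_of_le {t : ℝ} (hr : 0 < r) (ht : r ^ 2 ≤ t) : cutoffProfile r t = 0 := by
  refine Real.smoothTransition.zero_of_nonpos ?_
  rw [sub_nonpos, le_div_iff₀ (by positivity)]
  linarith

lemma cutoff_nonneg (r : ℝ) (c x : T2) : 0 ≤ cutoff r c x := Real.smoothTransition.nonneg _

lemma cutoff_self (r : ℝ) (c : T2) : cutoff r c c = 1 := by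
  simp [cutoff, flatNormSq, cutoffProfile_zero]

lemma cutoff_eventuallyEq_one (hr : 0 < r) (c : T2) : cutoff r c =ᶠ[𝓝 c] fun _ => 1 := by
  have hflat : Continuous fun x => flatNormSq (x - c) := by fun_prop
  filter_upwards [hflat.continuousAt.eventually_lt continuousAt_const
    (show flatNormSq (c - c) < r ^ 2 / 2 by simp [flatNormSq, hr])] with x hx
  refine Real.smoothTransition.one_of_one_le ?_
  rw [le_sub_comm, div_le_iff₀ (by positivity)]
  linarith

lemma tsupport_cutoff_subset (hr : 0 < r) : tsupport (cutoff r c) ⊆ Metric.closedBall c r := by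
  have hclosed : IsClosed {x | flatNormSq (x - c) ≤ r ^ 2} :=
    isClosed_le (by fun_prop) continuous_const
  refine (closure_minimal (fun x hx => ?_) hclosed).trans fun x hx => ?_
  · by_contra hlt
    exact hx (cutoffProfile_of_le hr (le_of_not_ge hlt))
  · rw [Metric.mem_closedBall, dist_eq_norm]
    exact le_of_sq_le_sq ((norm_sq_le_flatNormSq _).trans hx) hr.le

lemma lift_cutoff_eventuallyEq {z : ℂ} (hz : ‖z‖ < 1 / 2) :
    lift c (cutoff r c) =ᶠ[𝓝 z] fun w => cutoffProfile r (‖w‖ ^ 2) := by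
  filter_upwards [continuous_norm.continuousAt.eventually_lt continuousAt_const hz] with w hw
  simp only [lift, cutoff, add_sub_cancel_left, flatNormSq_cproj_of_norm_le hw.le]

lemma cutoff_eventuallyEq_zero (hr : 0 < r) (hx : r ^ 2 < flatNormSq (x - c)) :
    cutoff r c =ᶠ[𝓝 x] fun _ => 0 := by
  have hflat : Continuous fun x => flatNormSq (x - c) := by fun_prop
  filter_upwards [continuousAt_const.eventually_lt hflat.continuousAt hx] with y hy
  exact cutoffProfile_of_le hr hy.le

lemma smoothAt_cutoff (hr : 0 < r) (hr2 : r < 1 / 2) (n : ℕ∞) (c x : T2) :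
    SmoothAt n (cutoff r c) x := by
  by_cases hx : flatNormSq (x - c) < (1 / 2) ^ 2
  · obtain ⟨z, hz, hz_norm⟩ := exists_cproj_eq_of_flatNormSq (x - c)
    have hz2 : ‖z‖ < 1 / 2 := lt_of_pow_lt_pow_left₀ 2 (by norm_num) (hz_norm ▸ hx)
    rw [← add_sub_cancel c x, ← hz, smoothAt_add_cproj_iff]
    exact ((contDiff_cutoffProfile.comp (contDiff_norm_sq ℝ)).contDiffAt).congr_of_eventuallyEq
      (lift_cutoff_eventuallyEq hz2)
  · exact (smoothAt_const 0).congr (cutoff_eventuallyEq_zero hr (by nlinarith))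

lemma dbar_cutoff (hr : 0 < r) (hr2 : r < 1 / 2) {z : ℂ} (hz : ‖z‖ < 1 / 2) :
    dbar (fun x => (cutoff r c x : ℂ)) (c + cproj z) =
      deriv (cutoffProfile r) (‖z‖ ^ 2) * (2 * z) := by
  have hsmooth := smoothAt_cutoff hr hr2 1 c (c + cproj z)
  have hprofile : DifferentiableAt ℝ (cutoffProfile r) (‖z‖ ^ 2) :=
    (contDiff_cutoffProfile (n := 1)).differentiable one_ne_zero _
  have hfderiv : fderiv ℝ (lift c (cutoff r c)) z =
      deriv (cutoffProfile r) (‖z‖ ^ 2) • (2 • innerSL ℝ z) := by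
    rw [(lift_cutoff_eventuallyEq hz).fderiv_eq]
    exact (hprofile.hasDerivAt.comp_hasFDerivAt z
      (hasStrictFDerivAt_norm_sq z).hasFDerivAt).fderiv
  rw [dbar_ofReal hsmooth, pd_add_cproj_eq_fderiv hsmooth, pd_add_cproj_eq_fderiv hsmooth, hfderiv]
  apply Complex.ext <;> simp [dir, Complex.inner]

end Cutoff

section PlaneIntegrals

open Metric Set

lemma measurePreserving_cproj :
    MeasurePreserving cproj (volume.restrict (Ioc (-(1 / 2)) (1 / 2) ×ℂ Ioc (-(1 / 2)) (1 / 2)))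
      volume := by
  have hpi : MeasurePreserving (fun (y : Fin 2 → ℝ) (k : Fin 2) => (y k : UnitAddCircle))
      (volume.restrict (univ.pi fun _ => Ioc (-(1 / 2) : ℝ) (-(1 / 2) + 1))) volume := by
    rw [volume_pi, Measure.restrict_pi_pi]
    exact measurePreserving_pi _ _ fun _ => AddCircle.measurePreserving_mk 1 (-(1 / 2))
  have hequiv := Complex.volume_preserving_equiv_pi.restrict_preimage
    (MeasurableSet.univ_pi fun _ : Fin 2 => measurableSet_Ioc (a := (-(1 / 2) : ℝ))
      (b := -(1 / 2) + 1))
  have hcomp : cproj = (fun (y : Fin 2 → ℝ) (k : Fin 2) => (y k : UnitAddCircle)) ∘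
      Complex.measurableEquivPi := by
    ext z k
    fin_cases k <;> simp [cproj, Complex.measurableEquivPi]
  have hsquare : Ioc (-(1 / 2)) (1 / 2) ×ℂ Ioc (-(1 / 2)) (1 / 2) = Complex.measurableEquivPi ⁻¹'
      univ.pi fun _ : Fin 2 => Ioc (-(1 / 2) : ℝ) (-(1 / 2) + 1) := by
    ext z
    norm_num [Complex.measurableEquivPi, Complex.mem_reProdIm]
  rw [hcomp, hsquare]
  exact hpi.comp hequiv

lemma integral_eq_setIntegral_ball {E : Type*} [NormedAddCommGroup E] [NormedSpace ℝ E]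
    {g : T2 → E} (hg : Continuous g) (c : T2) {s : ℝ} (hs : 0 < s) (hs2 : s ≤ 1 / 2)
    (hzero : ∀ x, s ^ 2 ≤ flatNormSq (x - c) → g x = 0) :
    ∫ x, g x = ∫ z in ball 0 s, lift c g z := by
  have hball : ball (0 : ℂ) s ⊆ Ioc (-(1 / 2)) (1 / 2) ×ℂ Ioc (-(1 / 2)) (1 / 2) := fun z hz => by
    rw [mem_ball_zero_iff] at hz
    have hre := abs_lt.1 ((Complex.abs_re_le_norm z).trans_lt (hz.trans_le hs2))
    have him := abs_lt.1 ((Complex.abs_im_le_norm z).trans_lt (hz.trans_le hs2))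
    exact ⟨⟨hre.1, hre.2.le⟩, ⟨him.1, him.2.le⟩⟩
  calc ∫ x, g x = ∫ x, g (c + x) := (integral_add_left_eq_self g c).symm
    _ = ∫ z in Ioc (-(1 / 2)) (1 / 2) ×ℂ Ioc (-(1 / 2)) (1 / 2), lift c g z := by
        have hg' : Continuous fun x => g (c + x) := hg.comp (by fun_prop)
        rw [← measurePreserving_cproj.map_eq,
          integral_map continuous_cproj.aemeasurable hg'.aestronglyMeasurable]
        rfl
    _ = ∫ z in ball 0 s, lift c g z := by
        refine setIntegral_eq_of_subset_of_forall_sdiff_eq_zero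
          ((measurableSet_Ioc.preimage Complex.measurable_re).inter
            (measurableSet_Ioc.preimage Complex.measurable_im)) hball fun z hz => hzero _ ?_
        rw [add_sub_cancel_left, flatNormSq_cproj (abs_le.2 ⟨hz.1.1.1.le, hz.1.1.2⟩)
          (abs_le.2 ⟨hz.1.2.1.le, hz.1.2.2⟩)]
        exact pow_le_pow_left₀ hs.le (by simpa using hz.2) 2

lemma setIntegral_ball_eq_integral_circleMap {E : Type*} [NormedAddCommGroup E] [NormedSpace ℝ E]
    {g : ℂ → E} (hg : Continuous g) {s : ℝ} (hs : 0 ≤ s) :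
    ∫ z in ball 0 s, g z = ∫ ρ in 0..s, ρ • ∫ θ in 0..2 * Real.pi, g (circleMap 0 ρ θ) := by
  have hpolar : ∀ p : ℝ × ℝ, Complex.polarCoord.symm p = circleMap 0 p.1 p.2 := fun p => by
    simp [circleMap, Complex.polarCoord_symm_apply, Complex.exp_mul_I]
  have hcont : Continuous fun p : ℝ × ℝ => p.1 • g (circleMap 0 p.1 p.2) := by
    simp only [circleMap]
    fun_prop
  have hint : IntegrableOn (fun p : ℝ × ℝ => p.1 • g (circleMap 0 p.1 p.2))
      (Ioo 0 s ×ˢ Ioo (-Real.pi) Real.pi) :=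
    (hcont.continuousOn.integrableOn_compact (isCompact_Icc.prod isCompact_Icc)).mono_set
      (prod_mono Ioo_subset_Icc_self Ioo_subset_Icc_self)
  have hperiod : ∀ ρ, ∫ θ in Ioo (-Real.pi) Real.pi, g (circleMap 0 ρ θ) =
      ∫ θ in 0..2 * Real.pi, g (circleMap 0 ρ θ) := fun ρ => by
    have := ((periodic_circleMap 0 ρ).comp g).intervalIntegral_add_eq (-Real.pi) 0
    rw [← integral_Ioc_eq_integral_Ioo,
      ← intervalIntegral.integral_of_le (by linarith [Real.pi_pos])]
    simpa [two_mul] using this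
  calc ∫ z in ball 0 s, g z
      = ∫ p in polarCoord.target,
          (Ioo 0 s ×ˢ Ioo (-Real.pi) Real.pi).indicator
            (fun p : ℝ × ℝ => p.1 • g (circleMap 0 p.1 p.2)) p := by
        rw [← integral_indicator measurableSet_ball, ← Complex.integral_comp_polarCoord_symm]
        refine setIntegral_congr_fun polarCoord.open_target.measurableSet fun p hp => ?_
        obtain ⟨hp1, hp2⟩ := polarCoord_target ▸ hp
        have hmem : circleMap 0 p.1 p.2 ∈ ball (0 : ℂ) s ↔
            p ∈ Ioo 0 s ×ˢ Ioo (-Real.pi) Real.pi := by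
          simp [abs_of_pos hp1.out, hp1.out, hp2.1, hp2.2]
        by_cases hs : p ∈ Ioo 0 s ×ˢ Ioo (-Real.pi) Real.pi
        · simp [hpolar, indicator_of_mem, hs, hmem.2 hs]
        · simp [hpolar, indicator_of_notMem, hs, mt hmem.1 hs]
    _ = ∫ p in Ioo 0 s ×ˢ Ioo (-Real.pi) Real.pi, p.1 • g (circleMap 0 p.1 p.2) := by
        rw [setIntegral_indicator (measurableSet_Ioo.prod measurableSet_Ioo), polarCoord_target,
          inter_eq_right.2 (prod_mono Ioo_subset_Ioi_self subset_rfl)]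
    _ = ∫ ρ in Ioo 0 s, ρ • ∫ θ in 0..2 * Real.pi, g (circleMap 0 ρ θ) := by
        rw [Measure.volume_eq_prod, setIntegral_prod _ hint]
        simp only [integral_smul, hperiod]
    _ = ∫ ρ in 0..s, ρ • ∫ θ in 0..2 * Real.pi, g (circleMap 0 ρ θ) := by
        rw [intervalIntegral.integral_of_le hs, integral_Ioc_eq_integral_Ioo]

lemma setIntegral_ball_radial_deriv_mul {ψ : ℝ → ℝ} (hψ : ContDiff ℝ 1 ψ) {h : ℂ → ℂ} {R : ℂ}
    {s : ℝ} (hs : 0 ≤ s) (hcont : Continuous fun z : ℂ => deriv ψ (‖z‖ ^ 2) * (2 * z) * h z)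
    (hR : ∀ ρ ∈ Ioo 0 s, ∮ z in C(0, ρ), h z = 2 * Real.pi * Complex.I * R) :
    ∫ z in ball 0 s, deriv ψ (‖z‖ ^ 2) * (2 * z) * h z =
      2 * Real.pi * R * (ψ (s ^ 2) - ψ 0) := by
  have hcircle : ∀ ρ ∈ Ioo 0 s,
      ρ • ∫ θ in 0..2 * Real.pi, deriv ψ (‖circleMap 0 ρ θ‖ ^ 2) * (2 * circleMap 0 ρ θ) *
        h (circleMap 0 ρ θ) = 2 * Real.pi * R * (deriv ψ (ρ ^ 2) * (2 * ρ) : ℝ) := fun ρ hρ => by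
    have hRρ := hR ρ hρ
    simp only [circleIntegral, deriv_circleMap, smul_eq_mul] at hRρ
    have hintegrand : ∀ θ, deriv ψ (‖circleMap 0 ρ θ‖ ^ 2) * (2 * circleMap 0 ρ θ) *
        h (circleMap 0 ρ θ) = -Complex.I * 2 * deriv ψ (ρ ^ 2) *
          (circleMap 0 ρ θ * Complex.I * h (circleMap 0 ρ θ)) := fun θ => by
      rw [norm_circleMap_zero, sq_abs]
      linear_combination (2 * (deriv ψ (ρ ^ 2) : ℝ) * circleMap 0 ρ θ * h (circleMap 0 ρ θ)) *
        Complex.I_sq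
    simp only [hintegrand, intervalIntegral.integral_const_mul, hRρ, Complex.real_smul]
    push_cast
    linear_combination (-4 * ρ * (deriv ψ (ρ ^ 2) : ℝ) * Real.pi * R) * Complex.I_sq
  have hderiv : ∀ ρ : ℝ,
      HasDerivAt (fun ρ => ψ (ρ ^ 2)) (deriv ψ (ρ ^ 2) * (2 * ρ)) ρ := fun ρ => by
    simpa [Function.comp_def] using
      ((hψ.differentiable one_ne_zero (ρ ^ 2)).hasDerivAt).comp ρ (hasDerivAt_pow 2 ρ)
  rw [setIntegral_ball_eq_integral_circleMap hcont hs, intervalIntegral.integral_of_le hs,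
    integral_Ioc_eq_integral_Ioo, setIntegral_congr_fun measurableSet_Ioo hcircle,
    ← integral_Ioc_eq_integral_Ioo, ← intervalIntegral.integral_of_le hs,
    intervalIntegral.integral_const_mul, intervalIntegral.integral_ofReal,
    intervalIntegral.integral_eq_sub_of_hasDerivAt (fun ρ _ => hderiv ρ)
      (Continuous.intervalIntegrable
        (((hψ.continuous_deriv le_rfl).comp (continuous_pow 2)).mul (by fun_prop)) _ _)]
  norm_num

end PlaneIntegrals

/-- `h` has residue `R` at `c`. The residue is read off from small circles, so that no holomorphy
of `h` enters the definition. -/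
def HasResidue (h : T2 → ℂ) (c : T2) (R : ℂ) : Prop :=
  ∀ᶠ ρ in 𝓝[>] (0 : ℝ), ∮ z in C(0, ρ), lift c h z = 2 * Real.pi * Complex.I * R

section Residues

open Metric Set

variable {r : ℝ} {c x : T2} {g h : T2 → ℂ} {R : ℂ}

lemma notMem_tsupport_dbar {b : ℂ} (hg : g =ᶠ[𝓝 x] fun _ => b) : x ∉ tsupport (dbar g) := by
  rw [notMem_tsupport_iff_eventuallyEq]
  filter_upwards [hg.eventuallyEq_nhds] with y hy using dbar_eq_zero_of_eventuallyEq_const hy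

lemma continuous_dbar (hg : ∀ x, SmoothAt 1 g x) : Continuous (dbar g) :=
  continuous_of_smoothAt fun x => (hg x).smoothAt_dbar (m := 0) (by simp)

lemma deriv_cutoffProfile_of_le {t : ℝ} (hr : 0 < r) (ht : r ^ 2 ≤ t) :
    deriv (cutoffProfile r) t = 0 := by
  refine IsLocalMin.deriv_eq_zero (Eventually.of_forall fun s => ?_)
  rw [cutoffProfile_of_le hr ht]
  exact Real.smoothTransition.nonneg _

lemma dbar_cutoff_of_le (hr : 0 < r) (hr2 : r < 1 / 2) (hx : r ^ 2 ≤ flatNormSq (x - c)) :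
    dbar (fun y => (cutoff r c y : ℂ)) x = 0 := by
  have hpd : ∀ k, pd k (cutoff r c) x = 0 := fun k => by
    refine IsLocalMin.deriv_eq_zero (Eventually.of_forall fun t => ?_)
    simpa [cutoff, cutoffProfile_of_le hr hx] using cutoff_nonneg r c _
  simp [dbar_ofReal (smoothAt_cutoff hr hr2 1 c x), hpd]

lemma integral_dbar_cutoff_mul (hr : 0 < r) (hr2 : r < 1 / 2)
    (hh : ∀ x ∈ tsupport (cutoff r c), x ≠ c → ContinuousAt h x)
    (hR : ∀ ρ ∈ Ioo 0 r, ∮ z in C(0, ρ), lift c h z = 2 * Real.pi * Complex.I * R) :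
    Integrable (fun x => dbar (fun y => (cutoff r c y : ℂ)) x * h x) ∧
      ∫ x, dbar (fun y => (cutoff r c y : ℂ)) x * h x = -(2 * Real.pi * R) := by
  have hsmooth : ∀ x, SmoothAt 1 (fun y => (cutoff r c y : ℂ)) x := fun x =>
    (smoothAt_cutoff hr hr2 1 c x).ofReal
  have hcont : Continuous fun x => dbar (fun y => (cutoff r c y : ℂ)) x * h x := by
    refine continuous_mul_of_tsupport (continuous_dbar hsmooth) fun x hx => hh x ?_ ?_
    · refine not_imp_not.1 (fun hx0 => ?_) hx
      exact notMem_tsupport_dbar (b := (0 : ℝ))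
        ((notMem_tsupport_iff_eventuallyEq.1 hx0).fun_comp ((↑) : ℝ → ℂ))
    · rintro rfl
      exact notMem_tsupport_dbar ((cutoff_eventuallyEq_one hr x).fun_comp ((↑) : ℝ → ℂ)) hx
  have hlift : ∀ z : ℂ, ‖z‖ < 1 / 2 →
      lift c (fun x => dbar (fun y => (cutoff r c y : ℂ)) x * h x) z =
        deriv (cutoffProfile r) (‖z‖ ^ 2) * (2 * z) * lift c h z := fun z hz =>
    congrArg (· * lift c h z) (dbar_cutoff hr hr2 hz)
  have hplane : Continuous fun z : ℂ =>
      deriv (cutoffProfile r) (‖z‖ ^ 2) * (2 * z) * lift c h z := by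
    refine continuous_iff_continuousAt.2 fun z => ?_
    by_cases hz : ‖z‖ < 1 / 2
    · have hlc : Continuous (lift c fun x => dbar (fun y => (cutoff r c y : ℂ)) x * h x) :=
        hcont.comp (by fun_prop)
      refine hlc.continuousAt.congr ?_
      filter_upwards [continuous_norm.continuousAt.eventually_lt continuousAt_const hz] with w hw
        using hlift w hw
    · refine (continuousAt_const (y := (0 : ℂ))).congr ?_
      filter_upwards [continuousAt_const.eventually_lt continuous_norm.continuousAt
        (hr2.trans_le (not_lt.1 hz))] with w hw
      simp [deriv_cutoffProfile_of_le hr (pow_le_pow_left₀ hr.le hw.le 2)]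
  refine ⟨integrable_of_continuous hcont, ?_⟩
  rw [integral_eq_setIntegral_ball hcont c hr hr2.le
      fun x hx => by rw [dbar_cutoff_of_le hr hr2 hx, zero_mul],
    setIntegral_congr_fun measurableSet_ball fun z hz =>
      hlift z ((mem_ball_zero_iff.1 hz).trans hr2),
    setIntegral_ball_radial_deriv_mul contDiff_cutoffProfile hr.le hplane hR,
    cutoffProfile_of_le hr le_rfl, cutoffProfile_zero]
  simp

variable {ι : Type*} {a : ι → T2} {S : ι → ℂ}

lemma integrable_dbar_mul_of_eventuallyEq_const (hg : ∀ x, SmoothAt 1 g x)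
    (hga : ∀ j, ∀ᶠ x in 𝓝 (a j), g x = g (a j)) (hh : ∀ x ∉ range a, ContinuousAt h x) :
    Integrable fun x => dbar g x * h x := by
  refine integrable_of_continuous (continuous_mul_of_tsupport (continuous_dbar hg) fun x hx => ?_)
  refine hh x ?_
  rintro ⟨j, rfl⟩
  exact notMem_tsupport_dbar (hga j) hx

lemma exists_residue_radius [Finite ι] (ha : Function.Injective a)
    (hS : ∀ j, HasResidue h (a j) (S j)) :
    ∃ r, 0 < r ∧ r < 1 / 2 ∧ (∀ j k, j ≠ k → a k ∉ tsupport (cutoff r (a j))) ∧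
      ∀ j, ∀ ρ ∈ Ioo 0 r, ∮ z in C(0, ρ), lift (a j) h z = 2 * Real.pi * Complex.I * S j := by
  have hpos : ∀ᶠ r in 𝓝[>] (0 : ℝ), 0 < r := self_mem_nhdsWithin
  have hsmall : ∀ {ε : ℝ}, 0 < ε → ∀ᶠ r in 𝓝[>] (0 : ℝ), r < ε := fun hε =>
    nhdsWithin_le_nhds (Iio_mem_nhds hε)
  have hsep : ∀ᶠ r in 𝓝[>] (0 : ℝ), ∀ j k, j ≠ k → a k ∉ tsupport (cutoff r (a j)) := by
    refine eventually_all.2 fun j => eventually_all.2 fun k => ?_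
    rcases eq_or_ne j k with rfl | hjk
    · simp
    · filter_upwards [hpos, hsmall (dist_pos.2 (ha.ne hjk.symm))] with r hr hrd _ hmem
      exact hrd.not_ge (mem_closedBall.1 (tsupport_cutoff_subset hr hmem))
  have hcircle : ∀ᶠ r in 𝓝[>] (0 : ℝ), ∀ j, ∀ ρ ∈ Ioo 0 r,
      ∮ z in C(0, ρ), lift (a j) h z = 2 * Real.pi * Complex.I * S j := by
    refine eventually_all.2 fun j => ?_
    obtain ⟨u, hu, hsub⟩ := mem_nhdsGT_iff_exists_Ioo_subset.1 (hS j)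
    filter_upwards [hsmall hu] with r hr ρ hρ using hsub ⟨hρ.1, hρ.2.trans hr⟩
  exact (hpos.and ((hsmall one_half_pos).and (hsep.and hcircle))).exists

variable [Fintype ι]

lemma exists_interpolation_integral_dbar_mul (ha : Function.Injective a) (b : ι → ℂ)
    (hh : ∀ x ∉ range a, ContinuousAt h x) (hS : ∀ j, HasResidue h (a j) (S j)) :
    ∃ p : T2 → ℂ, (∀ x, SmoothAt 1 p x) ∧ (∀ k, ∀ᶠ x in 𝓝 (a k), p x = b k) ∧
      ∫ x, dbar p x * h x = -(2 * Real.pi * ∑ j, b j * S j) := by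
  classical
  obtain ⟨r, hr, hr2, hsep, hcircle⟩ := exists_residue_radius ha hS
  have hχh := fun j => integral_dbar_cutoff_mul (c := a j) (h := h) (R := S j) hr hr2
    (fun x hx hxj => hh x (by
      rintro ⟨k, rfl⟩
      exact hsep j k (fun hjk => hxj (hjk ▸ rfl)) hx)) (hcircle j)
  have hterm : ∀ j x, SmoothAt 1 (fun y => b j * (cutoff r (a j) y : ℂ)) x := fun j x =>
    (smoothAt_const _).mul (smoothAt_cutoff hr hr2 1 (a j) x).ofReal
  refine ⟨fun x => ∑ j, b j * (cutoff r (a j) x : ℂ),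
    fun x => SmoothAt.sum fun j _ => hterm j x, fun k => ?_, ?_⟩
  · have hindicator : ∀ᶠ x in 𝓝 (a k), ∀ j, cutoff r (a j) x = if j = k then 1 else 0 := by
      refine eventually_all.2 fun j => ?_
      split_ifs with hjk
      · exact hjk ▸ cutoff_eventuallyEq_one hr (a j)
      · exact notMem_tsupport_iff_eventuallyEq.1 (hsep j k hjk)
    filter_upwards [hindicator] with x hx
    simp [hx, apply_ite ((↑) : ℝ → ℂ)]
  · simp only [dbar_sum fun j _ => hterm j _, dbar_const_mul, Finset.sum_mul, mul_assoc]
    rw [integral_finsetSum _ fun j _ => (hχh j).1.const_mul _]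
    simp only [integral_const_mul, (hχh _).2, mul_neg, Finset.sum_neg_distrib, Finset.mul_sum,
      mul_left_comm, mul_assoc]

/-- Subtracting from `g` a sum of cutoffs with the same values at the poles leaves a function
vanishing near the poles, to which `integral_dbar_mul_eq_zero` applies. -/
theorem integral_dbar_mul_eq_sum_residue (ha : Function.Injective a) (hg : ∀ x, SmoothAt 1 g x)
    (hga : ∀ j, ∀ᶠ x in 𝓝 (a j), g x = g (a j)) (hh : ∀ x ∉ range a, SmoothAt 1 h x)
    (hdbar : ∀ x ∉ range a, dbar h x = 0) (hS : ∀ j, HasResidue h (a j) (S j)) :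
    ∫ x, dbar g x * h x = -(2 * Real.pi * ∑ j, g (a j) * S j) := by
  have hcont : ∀ x ∉ range a, ContinuousAt h x := fun x hx => (hh x hx).continuousAt
  obtain ⟨p, hp, hpa, hp_int⟩ :=
    exists_interpolation_integral_dbar_mul ha (fun j => g (a j)) hcont hS
  have hsupp : ∀ x ∈ tsupport fun y => g y - p y, x ∉ range a := by
    rintro _ hx ⟨k, rfl⟩
    refine notMem_tsupport_iff_eventuallyEq.2 ?_ hx
    filter_upwards [hga k, hpa k] with y hgy hpy
    simp [hgy, hpy]
  have hzero : ∫ x, dbar (fun y => g y - p y) x * h x = 0 :=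
    integral_dbar_mul_eq_zero (fun x => (hg x).sub (hp x)) (fun x hx => hh x (hsupp x hx))
      fun x hx => hdbar x (hsupp x hx)
  simp only [dbar_sub (hg _) (hp _), sub_mul] at hzero
  rw [integral_sub (integrable_dbar_mul_of_eventuallyEq_const hg hga hcont)
    (integrable_dbar_mul_of_eventuallyEq_const hp
      (fun j => by simpa only [(hpa j).self_of_nhds] using hpa j) hcont),
    hp_int, sub_eq_zero] at hzero
  exact hzero

end Residues

section PlaneHarmonic

open InnerProductSpace Laplacian Metric

/-- The complex gradient `u_x - i u_y` of a function on the plane, which is holomorphic when `u` is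
harmonic. -/
def cgrad (u : ℂ → ℝ) (z : ℂ) : ℂ := fderiv ℝ u z 1 - Complex.I * fderiv ℝ u z Complex.I

lemma cgrad_congr {u v : ℂ → ℝ} {z : ℂ} (h : u =ᶠ[𝓝 z] v) : cgrad u z = cgrad v z := by
  simp only [cgrad, h.fderiv_eq]

lemma cgrad_eq_deriv {u : ℂ → ℝ} {f : ℂ → ℂ} {z : ℂ} (hf : DifferentiableAt ℂ f z)
    (h : u =ᶠ[𝓝 z] fun w => (f w).re) : cgrad u z = deriv f z := by
  have hre : HasFDerivAt (fun w => (f w).re)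
      (Complex.reCLM.comp ((fderiv ℂ f z).restrictScalars ℝ)) z :=
    Complex.reCLM.hasFDerivAt.comp z (hf.hasFDerivAt.restrictScalars ℝ)
  rw [cgrad_congr h, cgrad, hre.fderiv]
  apply Complex.ext <;> simp [fderiv_eq_smul_deriv]

lemma cgrad_log_norm {z : ℂ} (hz : z ≠ 0) : cgrad (fun w => Real.log ‖w‖) z = z⁻¹ := by
  suffices key : ∀ c : ℂ, ‖c‖ = 1 → c * z ∈ Complex.slitPlane →
      cgrad (fun w => Real.log ‖w‖) z = z⁻¹ by
    rcases Complex.mem_slitPlane_or_neg_mem_slitPlane hz with h | h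
    · exact key 1 norm_one (by simpa using h)
    · exact key (-1) (by simp) (by simpa using h)
  intro c hc hcz
  have hlog : HasDerivAt (fun w => Complex.log (c * w)) (c / (c * z)) z := by
    simpa using ((hasDerivAt_id z).const_mul c).clog hcz
  rw [cgrad_eq_deriv hlog.differentiableAt, hlog.deriv]
  · rw [div_mul_cancel_left₀ (norm_pos_iff.1 (by simp [hc]))]
  · exact .of_forall fun w => by simp [Complex.log_re, hc]

lemma norm_deriv_le_of_re_le {f : ℂ → ℂ} {z : ℂ} {R M : ℝ} (hR : 0 < R) (hM : 0 < M)
    (hf : DifferentiableOn ℂ f (ball z R)) (hfM : ∀ w ∈ ball z R, (f w).re ≤ (f z).re + M) :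
    ‖deriv f z‖ ≤ 2 * M / R := by
  have hmaps : Set.MapsTo (fun w => z + w) (ball 0 R) (ball z R) := fun w hw => by
    simpa [dist_eq_norm] using hw
  have hbound : ∀ w ∈ ball (0 : ℂ) R, ‖f (z + w) - f z‖ ≤ 2 * M * ‖w‖ / (R - ‖w‖) := fun w hw =>
    Complex.borelCaratheodory_zero (f := fun w => f (z + w) - f z) hM
      ((hf.comp (by fun_prop) hmaps).sub_const _)
      (fun w hw => by
        simpa [sub_le_iff_le_add, add_comm] using hfM _ (hmaps hw)) hR hw (by simp)
  have hslope := (hasDerivAt_iff_tendsto_slope_zero.1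
    (hf.differentiableAt (ball_mem_nhds z hR)).hasDerivAt).norm
  have hlim : Tendsto (fun w : ℂ => 2 * M / (R - ‖w‖)) (𝓝[≠] 0) (𝓝 (2 * M / R)) := by
    have : ContinuousAt (fun w : ℂ => 2 * M / (R - ‖w‖)) 0 := by
      fun_prop (disch := simpa using hR.ne')
    simpa using this.continuousWithinAt.tendsto
  refine le_of_tendsto_of_tendsto hslope hlim ?_
  filter_upwards [self_mem_nhdsWithin, nhdsWithin_le_nhds (ball_mem_nhds 0 hR)] with w hw0 hwR
  have hw : 0 < ‖w‖ := norm_pos_iff.2 hw0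
  rw [norm_smul, norm_inv, inv_mul_le_iff₀ hw]
  calc ‖f (z + w) - f z‖ ≤ 2 * M * ‖w‖ / (R - ‖w‖) := hbound w hwR
    _ = ‖w‖ * (2 * M / (R - ‖w‖)) := by ring

lemma norm_cgrad_le_of_le {u : ℂ → ℝ} {z : ℂ} {R M : ℝ} (hR : 0 < R) (hM : 0 < M)
    (hu : HarmonicOnNhd u (ball z R)) (huM : ∀ w ∈ ball z R, u w ≤ u z + M) :
    ‖cgrad u z‖ ≤ 2 * M / R := by
  obtain ⟨f, hf, hfu⟩ := HarmonicOnNhd.exists_analyticOnNhd_ball_re_eq hu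
  have hz : z ∈ ball z R := mem_ball_self hR
  rw [cgrad_eq_deriv (hf z hz).differentiableAt
    (eventually_of_mem (ball_mem_nhds z hR) fun w hw => (hfu hw).symm)]
  refine norm_deriv_le_of_re_le hR hM hf.differentiableOn fun w hw => ?_
  simpa only [hfu hw, hfu hz] using huM w hw

lemma eventually_eq_of_isLocalMax_harmonicAt {u : ℂ → ℝ} {z : ℂ} (hu : HarmonicAt u z)
    (hmax : IsLocalMax u z) : ∀ᶠ w in 𝓝 z, u w = u z := by
  obtain ⟨R, hR, hball⟩ := Metric.eventually_nhds_iff_ball.1 hu.eventually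
  obtain ⟨f, hf, hfu⟩ := HarmonicOnNhd.exists_analyticOnNhd_ball_re_eq hball
  have hnorm : ∀ w ∈ ball z R, ‖Complex.exp (f w)‖ = Real.exp (u w) := fun w hw => by
    rw [Complex.norm_exp]
    exact congrArg _ (hfu hw)
  have hnhds := ball_mem_nhds z hR
  have hexp := Complex.eventually_eq_of_isLocalMax_norm (f := fun w => Complex.exp (f w)) (c := z)
    (eventually_of_mem hnhds fun w hw => (hf w hw).differentiableAt.cexp) <| by
      filter_upwards [hnhds, hmax] with w hw hwz
      simpa only [Function.comp_apply, hnorm w hw, hnorm z (mem_ball_self hR), Real.exp_le_exp]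
  filter_upwards [hexp, hnhds] with w heq hw
  simpa only [hnorm w hw, hnorm z (mem_ball_self hR), Real.exp_eq_exp] using congrArg norm heq

lemma cgrad_isLittleO_inv {h : ℂ → ℝ} {L : ℝ} (hh : ∀ᶠ z in 𝓝[≠] 0, HarmonicAt h z)
    (hL : Tendsto h (𝓝[≠] 0) (𝓝 L)) : cgrad h =o[𝓝[≠] 0] fun z => z⁻¹ := by
  refine Asymptotics.isLittleO_iff.2 fun ε hε => ?_
  have hclose : ∀ᶠ z in 𝓝[≠] 0, |h z - L| < ε / 4 :=
    hL.eventually (Metric.ball_mem_nhds L (by positivity))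
  obtain ⟨r, hr, hball⟩ := Metric.mem_nhdsWithin_iff.1 (hh.and hclose)
  filter_upwards [self_mem_nhdsWithin, nhdsWithin_le_nhds (ball_mem_nhds 0 (half_pos hr))]
    with z hz0 hzr
  have hz : 0 < ‖z‖ := norm_pos_iff.2 hz0
  have hsub : ∀ w ∈ ball z ‖z‖, HarmonicAt h w ∧ |h w - L| < ε / 4 := fun w hw => by
    rw [mem_ball, dist_eq_norm] at hw
    refine hball ⟨mem_ball_zero_iff.2 ?_, ?_⟩
    · linarith [norm_sub_norm_le w z, mem_ball_zero_iff.1 hzr]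
    · rintro rfl
      simp at hw
  have hbound := norm_cgrad_le_of_le hz (half_pos hε) (fun w hw => (hsub w hw).1) fun w hw => by
    have hw' := abs_lt.1 (hsub w hw).2
    have hz' := abs_lt.1 (hsub z (mem_ball_self hz)).2
    linarith
  rwa [mul_div_cancel₀ _ two_ne_zero, div_eq_mul_inv, ← norm_inv] at hbound

lemma exists_tendsto_cgrad {h : ℂ → ℝ} {L : ℝ} (hh : ∀ᶠ z in 𝓝[≠] 0, HarmonicAt h z)
    (hL : Tendsto h (𝓝[≠] 0) (𝓝 L)) : ∃ q, Tendsto (cgrad h) (𝓝[≠] 0) (𝓝 q) := by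
  refine ⟨_, Complex.tendsto_limUnder_of_differentiable_on_punctured_nhds_of_isLittleO
    (hh.mono fun z hz => HarmonicAt.differentiableAt_complex_partial hz) ?_⟩
  have hconst : (fun _ : ℂ => cgrad h 0) =o[𝓝[≠] 0] fun z : ℂ => z⁻¹ :=
    Asymptotics.isLittleO_const_left.2 (Or.inr tendsto_norm_inv_nhdsNE_zero_atTop)
  simpa only [sub_zero] using (cgrad_isLittleO_inv hh hL).sub hconst

lemma circleIntegral_sq_add_inv {Q : ℂ → ℂ} {ρ : ℝ} (hρ : 0 < ρ)
    (hQ : DifferentiableOn ℂ Q (closedBall 0 ρ)) (c : ℂ) :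
    (∮ z in C(0, ρ), (c * z⁻¹ + Q z) ^ 2) = 2 * Real.pi * Complex.I * (2 * c * Q 0) := by
  have hreg : DifferentiableOn ℂ (fun z => 2 * c * Q z + z * Q z ^ 2) (closedBall 0 ρ) := by
    fun_prop
  have hzpow : CircleIntegrable (fun z : ℂ => c ^ 2 * (z - 0) ^ (-2 : ℤ)) 0 ρ :=
    (circleIntegrable_sub_zpow_iff.2 (by simp [hρ.ne', abs_of_pos hρ, hρ.ne])).const_smul
  have hcauchy : CircleIntegrable (fun z => (z - 0)⁻¹ • (2 * c * Q z + z * Q z ^ 2)) 0 ρ := by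
    have hinv : ContinuousOn (fun z : ℂ => (z - 0)⁻¹) (sphere 0 ρ) :=
      ContinuousOn.inv₀ (by fun_prop) fun z hz => sub_ne_zero.2 (ne_of_mem_sphere hz hρ.ne')
    exact (hinv.smul (hreg.continuousOn.mono sphere_subset_closedBall)).circleIntegrable hρ.le
  calc (∮ z in C(0, ρ), (c * z⁻¹ + Q z) ^ 2)
      = ∮ z in C(0, ρ), (c ^ 2 * (z - 0) ^ (-2 : ℤ) +
          (z - 0)⁻¹ • (2 * c * Q z + z * Q z ^ 2)) := by
        refine circleIntegral.integral_congr hρ.le fun z hz => ?_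
        have hz0 : z ≠ 0 := ne_of_mem_sphere hz hρ.ne'
        simp only [sub_zero, zpow_neg, smul_eq_mul, zpow_ofNat]
        field_simp
        ring
    _ = 2 * Real.pi * Complex.I * (2 * c * Q 0) := by
        rw [circleIntegral.integral_add hzpow hcauchy, circleIntegral.integral_const_mul,
          circleIntegral.integral_sub_zpow_of_ne (by norm_num), mul_zero, zero_add,
          hreg.circleIntegral_sub_inv_smul (mem_ball_self hρ)]
        simp

lemma eventually_circleIntegral_sq {f : ℂ → ℂ} {c q : ℂ}
    (hf : ∀ᶠ z in 𝓝[≠] 0, DifferentiableAt ℂ f z)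
    (hlim : Tendsto (fun z => f z - c * z⁻¹) (𝓝[≠] 0) (𝓝 q)) :
    ∀ᶠ ρ in 𝓝[>] (0 : ℝ), (∮ z in C(0, ρ), f z ^ 2) = 2 * Real.pi * Complex.I * (2 * c * q) := by
  set Q : ℂ → ℂ := Function.update (fun z => f z - c * z⁻¹) 0 q with hQdef
  have hQ : AnalyticAt ℂ Q 0 := by
    refine Complex.analyticAt_of_differentiable_on_punctured_nhds_of_continuousAt ?_
      (continuousAt_update_same.2 hlim)
    filter_upwards [hf, self_mem_nhdsWithin] with z hz hz0
    refine ((hz.sub ((differentiableAt_inv hz0).const_mul c)).congr_of_eventuallyEq ?_)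
    filter_upwards [isOpen_ne.mem_nhds hz0] with w hw
    rw [hQdef, Function.update_of_ne hw]
    rfl
  obtain ⟨r, hr, hQr⟩ := hQ.exists_ball_analyticOnNhd
  filter_upwards [Ioo_mem_nhdsGT hr] with ρ ⟨hρ, hρr⟩
  have hQρ : DifferentiableOn ℂ Q (closedBall 0 ρ) :=
    hQr.differentiableOn.mono (closedBall_subset_ball hρr)
  rw [show q = Q 0 by simp [hQdef], ← circleIntegral_sq_add_inv hρ hQρ]
  refine circleIntegral.integral_congr hρ.le fun z hz => ?_
  simp only [hQdef, Function.update_of_ne (ne_of_mem_sphere hz hρ.ne')]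
  ring

lemma cgrad_add {u v : ℂ → ℝ} {z : ℂ} (hu : DifferentiableAt ℝ u z)
    (hv : DifferentiableAt ℝ v z) : cgrad (fun w => u w + v w) z = cgrad u z + cgrad v z := by
  simp only [cgrad, fderiv_fun_add hu hv, add_apply, Complex.ofReal_add]
  ring

lemma cgrad_sub {u v : ℂ → ℝ} {z : ℂ} (hu : DifferentiableAt ℝ u z)
    (hv : DifferentiableAt ℝ v z) : cgrad (fun w => u w - v w) z = cgrad u z - cgrad v z := by
  simp only [cgrad, fderiv_fun_sub hu hv, sub_apply, Complex.ofReal_sub]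
  ring

lemma fderiv_const_mul_norm_sq (c : ℝ) :
    fderiv ℝ (fun z : ℂ => c * ‖z‖ ^ 2) = fun z => (2 * c) • innerSL ℝ z := by
  ext z : 1
  rw [fderiv_const_mul ((contDiff_norm_sq ℝ (n := 1)).differentiable one_ne_zero z),
    fderiv_norm_sq_apply, ← Nat.cast_smul_eq_nsmul ℝ, smul_smul, Nat.cast_two, mul_comm]

lemma cgrad_const_mul_norm_sq (c : ℝ) (z : ℂ) :
    cgrad (fun w => c * ‖w‖ ^ 2) z = 2 * c * (starRingEnd ℂ) z := by
  apply Complex.ext <;> simp [cgrad, fderiv_const_mul_norm_sq, Complex.inner]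

lemma laplacian_const_mul_norm_sq (c : ℝ) (z : ℂ) :
    Δ (fun w : ℂ => c * ‖w‖ ^ 2) z = 4 * c := by
  have hinner : fderiv ℝ (fun z : ℂ => (2 * c) • innerSL ℝ z) z = (2 * c) • innerSL ℝ :=
    ((2 * c) • innerSL ℝ : ℂ →L[ℝ] ℂ →L[ℝ] ℝ).fderiv
  simp only [laplacian_eq_iteratedFDeriv_complexPlane, iteratedFDeriv_two_apply,
    fderiv_const_mul_norm_sq, hinner, Matrix.cons_val_zero, Matrix.cons_val_one, smul_apply,
    smul_eq_mul]
  rw [innerSL_apply_apply, innerSL_apply_apply, real_inner_self_eq_norm_sq,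
    real_inner_self_eq_norm_sq, norm_one, Complex.norm_I]
  ring

end PlaneHarmonic

section TorusHarmonic

open InnerProductSpace Laplacian

variable {u : T2 → ℝ} {x : T2}

lemma tgrad_add_cproj {w : ℂ} (hu : SmoothAt 1 u (x + cproj w)) :
    tgrad u (x + cproj w) = cgrad (lift x u) w := by
  simp [tgrad, cgrad, pd_add_cproj_eq_fderiv hu, dir]

lemma laplacian_lift {w : ℂ} (hu : SmoothAt 2 u (x + cproj w)) :
    Δ (lift x u) w = lap u (x + cproj w) := by
  have hshift : fderiv ℝ (lift (x + cproj w) u) = fun z => fderiv ℝ (lift x u) (w + z) := by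
    rw [lift_add_cproj]
    exact funext fun z => fderiv_comp_add_left w
  simp [laplacian_eq_iteratedFDeriv_complexPlane, iteratedFDeriv_two_apply, lap, dir,
    pd_pd_eq_fderiv_fderiv hu, hshift, fderiv_comp_add_left]

lemma harmonicAt_lift (hu : SmoothAt 2 u x) (hlap : ∀ᶠ y in 𝓝 x, lap u y = 0) :
    HarmonicAt (lift x u) 0 := by
  refine ⟨hu, ?_⟩
  filter_upwards [ContDiffAt.eventually hu (by simp), (tendsto_add_cproj x).eventually hlap]
    with v hv hlapv
  rw [laplacian_lift ((smoothAt_add_cproj_iff v).2 hv), hlapv, Pi.zero_apply]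

lemma SmoothAt.continuousAt_lap (hu : SmoothAt 2 u x) : ContinuousAt (lap u) x :=
  (SmoothAt.sum (n := 0) fun k _ =>
    (hu.smoothAt_pd (m := 1) (by norm_num) k).smoothAt_pd (by norm_num) k).continuousAt

/-- The set where `u` is maximal is closed and, away from `p`, open. -/
lemma le_of_lap_eq_zero {p : T2} (hu : Continuous u) (hsmooth : ∀ x ≠ p, SmoothAt 2 u x)
    (hlap : ∀ x ≠ p, lap u x = 0) (x : T2) : u x ≤ u p := by
  obtain ⟨y, -, hy⟩ := isCompact_univ.exists_isMaxOn Set.univ_nonempty hu.continuousOn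
  refine (isMaxOn_univ_iff.1 hy x).trans (le_of_eq ?_)
  by_contra hne
  have hopen : IsOpen {t | u t = u y} := isOpen_iff_mem_nhds.2 fun t (ht : u t = u y) => by
    have htp : t ≠ p := by
      rintro rfl
      exact hne ht.symm
    have hharm : HarmonicAt (lift t u) 0 :=
      harmonicAt_lift (hsmooth t htp) (eventually_of_mem (isOpen_ne.mem_nhds htp) hlap)
    have hmax : IsLocalMax (lift t u) 0 := .of_forall fun z => by
      rw [lift_zero, ht]
      exact isMaxOn_univ_iff.1 hy _
    rw [← map_nhds_add_cproj t, mem_map]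
    filter_upwards [eventually_eq_of_isLocalMax_harmonicAt hharm hmax] with z hz
    rwa [lift_zero, ht] at hz
  have huniv : {t | u t = u y} = Set.univ :=
    IsClopen.eq_univ ⟨isClosed_eq hu continuous_const, hopen⟩ ⟨y, rfl⟩
  exact hne (huniv.symm ▸ Set.mem_univ p : p ∈ {t | u t = u y}).symm

lemma eq_zero_of_integral_cutoff_mul_eq_zero {f : T2 → ℝ} (hf : ∀ᶠ y in 𝓝 x, ContinuousAt f y)
    (hint : ∀ᶠ r in 𝓝[>] (0 : ℝ), ∫ y, cutoff r x y * f y = 0) : f x = 0 := by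
  suffices key : ∀ g : T2 → ℝ, (∀ᶠ y in 𝓝 x, ContinuousAt g y) →
      (∀ᶠ r in 𝓝[>] (0 : ℝ), ∫ y, cutoff r x y * g y = 0) → g x ≤ 0 by
    refine le_antisymm (key f hf hint) (neg_nonpos.1 (key (fun y => -f y) ?_ ?_))
    · exact hf.mono fun y hy => hy.neg
    · exact hint.mono fun r hr => by simp only [mul_neg, integral_neg, hr, neg_zero]
  intro g hg hint
  by_contra! hpos
  obtain ⟨R, hR, hball⟩ := Metric.eventually_nhds_iff_ball.1
    (hg.and (hg.self_of_nhds.eventually_const_lt hpos))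
  obtain ⟨r, hzero, hr, hr2⟩ :=
    (hint.and (Ioo_mem_nhdsGT (lt_min hR (by norm_num : (0 : ℝ) < 1 / 2)))).exists
  have hsupp : ∀ y ∈ tsupport (cutoff r x), ContinuousAt g y ∧ 0 < g y := fun y hy =>
    hball y (Metric.closedBall_subset_ball (hr2.trans_le (min_le_left _ _))
      (tsupport_cutoff_subset hr hy))
  have hcont : Continuous fun y => cutoff r x y * g y :=
    continuous_mul_of_tsupport (continuous_of_smoothAt
      (smoothAt_cutoff hr (hr2.trans_le (min_le_right _ _)) 0 x)) fun y hy => (hsupp y hy).1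
  have hnonneg : 0 ≤ fun y => cutoff r x y * g y := fun y => by
    by_cases hy : y ∈ tsupport (cutoff r x)
    · exact mul_nonneg (cutoff_nonneg r x y) (hsupp y hy).2.le
    · simp [image_eq_zero_of_notMem_tsupport hy]
  refine (hcont.integral_pos_of_hasCompactSupport_nonneg_nonzero
    (HasCompactSupport.of_compactSpace _) hnonneg (x := x) ?_).ne' hzero
  simpa [cutoff_self] using hpos.ne'

end TorusHarmonic

section Green

open InnerProductSpace

variable {F : T2 → ℝ} {x : T2}

lemma IsGreen.smoothAt (hF : IsGreen F) (hx : x ≠ 0) : SmoothAt 2 F x :=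
  hF.contDiffOn.smoothAt (isOpen_compl_singleton.mem_nhds hx)

lemma IsGreen.tendsto_sub_log (hF : IsGreen F) :
    Tendsto (fun z : ℂ => F (cproj z) - Real.log ‖z‖) (𝓝[≠] 0) (𝓝 0) := by
  have hrepr : Tendsto (fun z : ℂ => Complex.orthonormalBasisOneI.repr z) (𝓝[≠] 0) (𝓝[≠] 0) := by
    simpa using Complex.orthonormalBasisOneI.repr.continuous.continuousWithinAt.tendsto_nhdsWithin
      (s := {0}ᶜ) (x := 0) (t := {0}ᶜ) fun z hz => by simpa using hz
  simpa only [Function.comp_def, LinearIsometryEquiv.norm_map, ← cproj_eq_proj] using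
    hF.normalized.comp hrepr

lemma IsGreen.lap_eq (hF : IsGreen F) (hx : x ≠ 0) : lap F x = -(2 * Real.pi) := by
  have hne : ∀ᶠ y in 𝓝 x, y ≠ 0 := isOpen_ne.mem_nhds hx
  suffices h : lap F x + 2 * Real.pi = 0 by linarith
  refine eq_zero_of_integral_cutoff_mul_eq_zero (f := fun y => lap F y + 2 * Real.pi)
    (hne.mono fun y hy => (hF.smoothAt hy).continuousAt_lap.add continuousAt_const) ?_
  obtain ⟨R, hR, hball⟩ := Metric.eventually_nhds_iff_ball.1 hne
  filter_upwards [Ioo_mem_nhdsGT (lt_min hR (by norm_num : (0 : ℝ) < 1 / 2))] with r ⟨hr, hr2⟩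
  have hsmooth := smoothAt_cutoff hr (hr2.trans_le (min_le_right _ _))
  have hsupp : ∀ y ∈ tsupport (cutoff r x), y ≠ 0 := fun y hy =>
    hball y (Metric.closedBall_subset_ball (hr2.trans_le (min_le_left _ _))
      (tsupport_cutoff_subset hr hy))
  have hcutoff : Continuous (cutoff r x) := continuous_of_smoothAt (hsmooth 0 x)
  have hweak := hF.laplacian _ (torusContDiff_of_smoothAt (hsmooth ⊤ x))
  rw [integral_mul_lap (hsmooth 2 x) fun y hy => hF.smoothAt (hsupp y hy),
    image_eq_zero_of_notMem_tsupport fun h0 => hsupp 0 h0 rfl] at hweak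
  simp only [mul_add]
  rw [integral_add (integrable_of_continuous (continuous_mul_of_tsupport hcutoff
    fun y hy => (hF.smoothAt (hsupp y hy)).continuousAt_lap))
    ((integrable_of_continuous hcutoff).mul_const _), hweak, integral_mul_const]
  ring

lemma tendsto_neg_nhdsNE_zero : Tendsto (fun z : ℂ => -z) (𝓝[≠] 0) (𝓝[≠] 0) := by
  simpa using continuous_neg.continuousWithinAt.tendsto_nhdsWithin
    (s := {0}ᶜ) (x := (0 : ℂ)) (t := {0}ᶜ) fun z hz => by simpa using hz

/-- The odd part of `F` is continuous at the pole, where it vanishes, and harmonic elsewhere, so it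
vanishes by the maximum principle. -/
lemma IsGreen.even (hF : IsGreen F) (x : T2) : F (-x) = F x := by
  set G : T2 → ℝ := fun y => F y - F (-y) with hG
  have hsmooth : ∀ y ≠ 0, SmoothAt 2 G y := fun y hy =>
    (hF.smoothAt hy).sub (hF.smoothAt (neg_ne_zero.2 hy)).comp_neg
  have hlap : ∀ y ≠ 0, lap G y = 0 := fun y hy => by
    rw [lap_sub (hF.smoothAt hy) (hF.smoothAt (neg_ne_zero.2 hy)).comp_neg, lap_comp_neg,
      hF.lap_eq hy, hF.lap_eq (neg_ne_zero.2 hy), sub_self]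
  have hzero : ContinuousAt G 0 := by
    rw [← continuousAt_lift_iff, continuousAt_iff_punctured_nhds, lift_zero]
    convert hF.tendsto_sub_log.sub (hF.tendsto_sub_log.comp tendsto_neg_nhdsNE_zero) using 2
    · simp [hG, lift, cproj_neg]
    · simp [hG]
  have hcont : Continuous G := continuous_iff_continuousAt.2 fun y => by
    rcases eq_or_ne y 0 with rfl | hy
    exacts [hzero, (hsmooth y hy).continuousAt]
  have hle : ∀ y, F y ≤ F (-y) := fun y => by
    simpa [hG] using le_of_lap_eq_zero hcont hsmooth hlap y
  exact le_antisymm (by simpa using hle (-x)) (hle x)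

lemma IsGreen.tgrad_neg (hF : IsGreen F) (x : T2) : tgrad F (-x) = -tgrad F x := by
  have hpd : ∀ k, pd k F (-x) = -pd k F x := fun k => by
    have := pd_comp_neg k F x
    rw [funext hF.even] at this
    rw [this, neg_neg]
  rw [tgrad, hpd, hpd, tgrad]
  push_cast
  ring

lemma eventually_cproj_ne_zero : ∀ᶠ z in 𝓝[≠] 0, cproj z ≠ 0 := by
  filter_upwards [self_mem_nhdsWithin,
    nhdsWithin_le_nhds (Metric.ball_mem_nhds (0 : ℂ) one_half_pos)] with z hz0 hz hzero
  have hnorm := flatNormSq_cproj_of_norm_le (mem_ball_zero_iff.1 hz).le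
  rw [hzero] at hnorm
  exact hz0 (by simpa [flatNormSq] using hnorm.symm)

lemma IsGreen.harmonicAt_lift_add_norm_sq (hF : IsGreen F) {z : ℂ} (hz : cproj z ≠ 0) :
    HarmonicAt (fun w => lift 0 F w + Real.pi / 2 * ‖w‖ ^ 2) z := by
  have hsmooth : ∀ {w}, cproj w ≠ 0 → SmoothAt 2 F (0 + cproj w) := fun hw =>
    hF.smoothAt (by rwa [zero_add])
  have hnorm : ∀ {w}, ContDiffAt ℝ 2 (fun w : ℂ => Real.pi / 2 * ‖w‖ ^ 2) w :=
    (contDiff_const.mul (contDiff_norm_sq ℝ)).contDiffAt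
  refine ⟨((smoothAt_add_cproj_iff z).1 (hsmooth hz)).add hnorm, ?_⟩
  filter_upwards [continuous_cproj.continuousAt.eventually_ne hz] with w hw
  refine (((smoothAt_add_cproj_iff w).1 (hsmooth hw)).laplacian_add hnorm).trans ?_
  rw [laplacian_lift (hsmooth hw), hF.lap_eq (by rwa [zero_add]), laplacian_const_mul_norm_sq,
    Pi.zero_apply]
  ring

lemma IsGreen.tgrad_cproj_sub_inv (hF : IsGreen F) {z : ℂ} (hz : cproj z ≠ 0) (hz0 : z ≠ 0) :
    tgrad F (cproj z) - z⁻¹ =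
      cgrad (fun w => lift 0 F w + Real.pi / 2 * ‖w‖ ^ 2 - Real.log ‖w‖) z
        - Real.pi * (starRingEnd ℂ) z := by
  have hF1 : SmoothAt 1 F (0 + cproj z) := (hF.smoothAt (by rwa [zero_add])).of_le one_le_two
  have hlift := ((smoothAt_add_cproj_iff z).1 hF1).differentiableAt one_ne_zero
  have hsq : DifferentiableAt ℝ (fun w : ℂ => Real.pi / 2 * ‖w‖ ^ 2) z :=
    ((contDiff_norm_sq ℝ (n := 1)).differentiable one_ne_zero z).const_mul _
  have hlog : DifferentiableAt ℝ (fun w : ℂ => Real.log ‖w‖) z :=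
    (analyticAt_id.harmonicAt_log_norm hz0).1.differentiableAt two_ne_zero
  rw [cgrad_sub (hlift.fun_add hsq) hlog, cgrad_add hlift hsq, ← tgrad_add_cproj hF1,
    cgrad_const_mul_norm_sq, cgrad_log_norm hz0, zero_add]
  push_cast
  ring

/-- After subtracting `log |z|` and correcting the constant Laplacian by `π |z|² / 2`, the lift of
`F` is harmonic across the pole, so its complex gradient has a limit there; the limit vanishes
because the gradient is odd. -/
lemma IsGreen.tendsto_tgrad_sub_inv (hF : IsGreen F) :
    Tendsto (fun z => tgrad F (cproj z) - z⁻¹) (𝓝[≠] 0) (𝓝 0) := by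
  set u : ℂ → ℝ := fun w => lift 0 F w + Real.pi / 2 * ‖w‖ ^ 2 with hu
  have hharm : ∀ᶠ z in 𝓝[≠] (0 : ℂ), HarmonicAt (fun w => u w - Real.log ‖w‖) z := by
    filter_upwards [eventually_cproj_ne_zero, self_mem_nhdsWithin] with z hcz hz
    exact (hF.harmonicAt_lift_add_norm_sq hcz).sub (analyticAt_id.harmonicAt_log_norm hz)
  have hnorm : Tendsto (fun z : ℂ => Real.pi / 2 * ‖z‖ ^ 2) (𝓝[≠] 0) (𝓝 0) := by
    have : Continuous fun z : ℂ => Real.pi / 2 * ‖z‖ ^ 2 := by fun_prop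
    simpa using this.continuousWithinAt.tendsto (x := 0) (s := {0}ᶜ)
  have hlim : Tendsto (fun w => u w - Real.log ‖w‖) (𝓝[≠] 0) (𝓝 0) := by
    convert hF.tendsto_sub_log.add hnorm using 2 with z
    · simp only [hu, lift, zero_add]
      ring
    · simp
  obtain ⟨q, hq⟩ := exists_tendsto_cgrad hharm hlim
  have hconj : Tendsto (fun z : ℂ => Real.pi * (starRingEnd ℂ) z) (𝓝[≠] 0) (𝓝 0) := by
    have : Continuous fun z : ℂ => (Real.pi : ℂ) * (starRingEnd ℂ) z := by fun_prop
    simpa using this.continuousWithinAt.tendsto (x := 0) (s := {0}ᶜ)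
  have htgrad : Tendsto (fun z => tgrad F (cproj z) - z⁻¹) (𝓝[≠] 0) (𝓝 q) := by
    rw [← sub_zero q]
    refine (hq.sub hconj).congr' ?_
    filter_upwards [eventually_cproj_ne_zero, self_mem_nhdsWithin] with z hcz hz
    exact (hF.tgrad_cproj_sub_inv hcz hz).symm
  have hodd : Tendsto (fun z => tgrad F (cproj z) - z⁻¹) (𝓝[≠] 0) (𝓝 (-q)) := by
    refine (htgrad.comp tendsto_neg_nhdsNE_zero).neg.congr fun z => ?_
    simp only [Function.comp_apply, cproj_neg, hF.tgrad_neg, inv_neg]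
    ring
  rwa [self_eq_neg.1 (tendsto_nhds_unique htgrad hodd)] at htgrad

end Green

section Potential

open Set

/-- The potential `x ↦ ∑ j, q_j F(x - a_j)` of real charges `q` at the points `a`; `potential` is
the case of integer charges. -/
def weightedPotential {ι : Type*} [Fintype ι] (F : T2 → ℝ) (a : ι → T2) (q : ι → ℝ) (x : T2) : ℝ :=
  ∑ j, q j * F (x - a j)

variable {ι : Type*} {F : T2 → ℝ} {a : ι → T2} {q : ι → ℝ} {x : T2}

lemma sub_ne_zero_of_notMem_range (hx : x ∉ range a) (j : ι) : x - a j ≠ 0 :=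
  sub_ne_zero.2 fun h => hx ⟨j, h.symm⟩

lemma IsGreen.smoothAt_comp_sub (hF : IsGreen F) (hx : x ∉ range a) (j : ι) :
    SmoothAt 2 (fun y => F (y - a j)) x :=
  (hF.smoothAt (sub_ne_zero_of_notMem_range hx j)).comp_sub

lemma eventually_notMem_range [Finite ι] (hx : x ∉ range a) : ∀ᶠ y in 𝓝 x, y ∉ range a :=
  (finite_range a).isClosed.isOpen_compl.mem_nhds hx

lemma eventually_add_cproj_notMem_range [Finite ι] (ha : Function.Injective a) (i : ι) :
    ∀ᶠ z in 𝓝[≠] 0, a i + cproj z ∉ range a := by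
  have hne : ∀ᶠ z in 𝓝[≠] 0, ∀ j, a i + cproj z ≠ a j := eventually_all.2 fun j => by
    rcases eq_or_ne i j with rfl | hij
    · simpa using eventually_cproj_ne_zero
    · exact ((tendsto_add_cproj (a i)).mono_left nhdsWithin_le_nhds).eventually_ne (ha.ne hij)
  exact hne.mono fun z hz ⟨j, hj⟩ => hz j hj.symm

variable [Fintype ι]

lemma smoothAt_weightedPotential (hF : IsGreen F) (hx : x ∉ range a) :
    SmoothAt 2 (weightedPotential F a q) x :=
  SmoothAt.sum fun j _ => (smoothAt_const _).mul (hF.smoothAt_comp_sub hx j)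

lemma tgrad_weightedPotential (hF : IsGreen F) (hx : x ∉ range a) :
    tgrad (weightedPotential F a q) x = ∑ j, q j * tgrad F (x - a j) := by
  have hpd : ∀ k, pd k (weightedPotential F a q) x = ∑ j, q j * pd k F (x - a j) := fun k => by
    refine (pd_sum (fun j _ => (smoothAt_const _).mul
      ((hF.smoothAt_comp_sub hx j).of_le one_le_two)) k).trans ?_
    simp only [pd_const_mul, pd_comp_sub]
  simp only [tgrad, hpd, Complex.ofReal_sum, Complex.ofReal_mul, Finset.mul_sum,
    ← Finset.sum_sub_distrib]
  exact Finset.sum_congr rfl fun j _ => by ring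

lemma smoothAt_tgrad_weightedPotential (hF : IsGreen F) (hx : x ∉ range a) :
    SmoothAt 1 (tgrad (weightedPotential F a q)) x :=
  (smoothAt_weightedPotential hF hx).smoothAt_tgrad (by norm_num)

lemma dbar_tgrad_weightedPotential (hF : IsGreen F) (hq : ∑ j, q j = 0) (hx : x ∉ range a) :
    dbar (tgrad (weightedPotential F a q)) x = 0 := by
  have hne := sub_ne_zero_of_notMem_range hx
  have hsmooth : ∀ j, SmoothAt 1 (fun y => tgrad F (y - a j)) x := fun j =>
    ((hF.smoothAt (hne j)).smoothAt_tgrad (by norm_num)).comp_sub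
  calc dbar (tgrad (weightedPotential F a q)) x
      = dbar (fun y => ∑ j, q j * tgrad F (y - a j)) x :=
        dbar_congr ((eventually_notMem_range hx).mono fun y hy => tgrad_weightedPotential hF hy)
    _ = ∑ j, q j * dbar (tgrad F) (x - a j) := by
        rw [dbar_sum fun j _ => (smoothAt_const _).mul (hsmooth j)]
        simp only [dbar_const_mul, dbar_comp_sub]
    _ = ((∑ j, q j : ℝ) : ℂ) * (-(2 * Real.pi) : ℝ) := by
        simp only [dbar_tgrad (hF.smoothAt (hne _)), hF.lap_eq (hne _), Complex.ofReal_sum,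
          Finset.sum_mul]
    _ = 0 := by rw [hq, Complex.ofReal_zero, zero_mul]

lemma tendsto_tgrad_weightedPotential_sub [DecidableEq ι] (hF : IsGreen F)
    (ha : Function.Injective a) (i : ι) :
    Tendsto (fun z => tgrad (weightedPotential F a q) (a i + cproj z) - q i * z⁻¹) (𝓝[≠] 0)
      (𝓝 (∑ j with j ≠ i, q j * tgrad F (a i - a j))) := by
  have hregular : ∀ j, j ≠ i → Tendsto (fun z => q j * tgrad F (a i - a j + cproj z)) (𝓝[≠] 0)
      (𝓝 (q j * tgrad F (a i - a j))) := fun j hj => by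
    have hcont : ContinuousAt (tgrad F) (a i - a j) :=
      ((hF.smoothAt (sub_ne_zero.2 (ha.ne hj.symm))).smoothAt_tgrad (m := 0) (by simp)).continuousAt
    exact ((hcont.tendsto.comp (tendsto_add_cproj _)).mono_left nhdsWithin_le_nhds).const_mul _
  have hsum := (hF.tendsto_tgrad_sub_inv.const_mul (q i : ℂ)).add
    (tendsto_finsetSum (Finset.univ.filter (· ≠ i)) fun j hj =>
      hregular j (Finset.mem_filter.1 hj).2)
  rw [mul_zero, zero_add] at hsum
  refine hsum.congr' ?_
  filter_upwards [eventually_add_cproj_notMem_range ha i] with z hz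
  rw [tgrad_weightedPotential hF hz, ← Finset.add_sum_erase _ _ (Finset.mem_univ i),
    Finset.filter_ne' Finset.univ i]
  simp only [add_sub_cancel_left, add_sub_right_comm]
  ring

lemma hasResidue_tgrad_weightedPotential_sq [DecidableEq ι] (hF : IsGreen F)
    (hq : ∑ j, q j = 0) (ha : Function.Injective a) (i : ι) :
    HasResidue (fun x => tgrad (weightedPotential F a q) x ^ 2) (a i)
      (2 * q i * ∑ j with j ≠ i, q j * tgrad F (a i - a j)) := by
  refine eventually_circleIntegral_sq ?_ (tendsto_tgrad_weightedPotential_sub hF ha i)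
  filter_upwards [eventually_add_cproj_notMem_range ha i] with z hz
  exact differentiableAt_lift_of_dbar_eq_zero (smoothAt_tgrad_weightedPotential hF hz)
    (dbar_tgrad_weightedPotential hF hq hz)

end Potential

section Integrand

variable {η : T2 → ℝ} {v : T2 → Fin 2 → ℝ} {x c : T2}

lemma integrand_eq_im (hη : SmoothAt 2 η x) :
    integrand η v x =
      (dbar (dbar fun y => (η y : ℂ)) x * (v x 1 + Complex.I * v x 0) ^ 2).im / 2 := by
  have hpd : ∀ k, SmoothAt 1 (pd k η) x := fun k => hη.smoothAt_pd (by norm_num) k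
  have hdbar : (dbar fun y => (η y : ℂ)) =ᶠ[𝓝 x] fun y => pd 0 η y + Complex.I * pd 1 η y :=
    (hη.of_le one_le_two).eventually_smoothAt.mono fun y hy => dbar_ofReal hy
  rw [dbar_congr hdbar, dbar_add (hpd 0).ofReal ((smoothAt_const _).mul (hpd 1).ofReal),
    dbar_const_mul, dbar_ofReal (hpd 0), dbar_ofReal (hpd 1)]
  simp only [integrand, J, Matrix.of_apply, Matrix.cons_val', Matrix.cons_val_fin_one,
    Fin.sum_univ_two, Matrix.cons_val_zero, Matrix.cons_val_one, pd_comm hη 1 0, sq,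
    Complex.mul_im, Complex.mul_re, Complex.add_re, Complex.add_im, Complex.ofReal_re,
    Complex.ofReal_im, Complex.I_re, Complex.I_im]
  ring

lemma integrand_neg_curl_eq_im {Φ : T2 → ℝ} (hη : SmoothAt 2 η x) (hv : v x = -curl Φ x) :
    integrand η v x = (dbar (dbar fun y => (η y : ℂ)) x * tgrad Φ x ^ 2).im / 2 := by
  rw [integrand_eq_im hη, hv, tgrad]
  simp [curl, sub_eq_add_neg]

lemma grad_dotProduct_curl {f : T2 → ℝ} (hη : SmoothAt 1 η x) (y : T2) :
    grad η x ⬝ᵥ curl f y = -(dbar (fun y => (η y : ℂ)) x * tgrad f y).im := by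
  simp only [dotProduct, grad, curl, Fin.sum_univ_two, Matrix.cons_val_zero, Matrix.cons_val_one,
    Matrix.cons_val_fin_one, dbar_ofReal hη, tgrad, Complex.mul_im, Complex.mul_re, Complex.add_re,
    Complex.add_im, Complex.sub_re, Complex.sub_im, Complex.ofReal_re, Complex.ofReal_im,
    Complex.I_re, Complex.I_im]
  ring

lemma grad_dotProduct_sum_smul_curl {ι : Type*} {f : T2 → ℝ} (hη : SmoothAt 1 η x)
    (s : Finset ι) (q : ι → ℝ) (y : ι → T2) :
    grad η x ⬝ᵥ ∑ j ∈ s, q j • curl f (y j) =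
      -(dbar (fun y => (η y : ℂ)) x * ∑ j ∈ s, q j * tgrad f (y j)).im := by
  simp only [dotProduct_sum, dotProduct_smul, grad_dotProduct_curl hη, Finset.mul_sum,
    Complex.im_sum, ← Finset.sum_neg_distrib, mul_left_comm _ (q _ : ℂ), Complex.im_ofReal_mul,
    smul_eq_mul, mul_neg]

lemma eventuallyEq_const_of_pd_eq_zero (hη : ∀ᶠ x in 𝓝 c, SmoothAt 1 η x)
    (h : ∀ᶠ x in 𝓝 c, ∀ k, pd k η x = 0) : η =ᶠ[𝓝 c] fun _ => η c := by
  have hboth := hη.and h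
  rw [← map_nhds_add_cproj c, eventually_map] at hboth
  obtain ⟨R, hR, hball⟩ := Metric.eventually_nhds_iff_ball.1 hboth
  have hfderiv : ∀ w ∈ Metric.ball (0 : ℂ) R, fderiv ℝ (lift c η) w = 0 := fun w hw => by
    obtain ⟨hsmooth, hpd⟩ := hball w hw
    refine ContinuousLinearMap.coe_injective (Complex.basisOneI.ext fun k => ?_)
    have := hpd k
    rw [pd_add_cproj_eq_fderiv hsmooth] at this
    fin_cases k <;> simpa [dir] using this
  have hdiff : DifferentiableOn ℝ (lift c η) (Metric.ball 0 R) := fun w hw =>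
    (((smoothAt_add_cproj_iff w).1 (hball w hw).1).differentiableAt
      one_ne_zero).differentiableWithinAt
  rw [← map_nhds_add_cproj c, EventuallyEq, eventually_map]
  filter_upwards [Metric.ball_mem_nhds 0 hR] with w hw
  rw [← lift_zero (x := c) (f := η)]
  exact Metric.isOpen_ball.is_const_of_fderiv_eq_zero (convex_ball 0 R).isPreconnected hdiff
    hfderiv hw (Metric.mem_ball_self hR)

lemma dbar_ofReal_eventuallyEq_const (hη : ∀ x, SmoothAt 2 η x)
    (hflat : ∀ᶠ x in 𝓝 c, ∀ j l, pd l (pd j η) x = 0) :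
    (dbar fun y => (η y : ℂ)) =ᶠ[𝓝 c] fun _ => dbar (fun y => (η y : ℂ)) c := by
  have hconst : ∀ k, pd k η =ᶠ[𝓝 c] fun _ => pd k η c := fun k =>
    eventuallyEq_const_of_pd_eq_zero (.of_forall fun x => (hη x).smoothAt_pd (by norm_num) k)
      (hflat.mono fun x hx => hx k)
  have hdbar : ∀ x, dbar (fun y => (η y : ℂ)) x = pd 0 η x + Complex.I * pd 1 η x := fun x =>
    dbar_ofReal ((hη x).of_le one_le_two)
  filter_upwards [hconst 0, hconst 1] with x hx0 hx1
  rw [hdbar, hdbar, hx0, hx1]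

end Integrand

section ResidueFormula

open Set

variable {ι : Type*} [Fintype ι] {F : T2 → ℝ} {a : ι → T2} {q : ι → ℝ}
  {η : T2 → ℝ} {v : T2 → Fin 2 → ℝ}

/-- At the poles both sides vanish, whatever the values of `v` there. -/
lemma integrand_eq_im_dbar_mul_tgrad_sq (hη : ∀ x, SmoothAt 2 η x)
    (hflat : ∀ j, ∀ᶠ x in 𝓝 (a j), ∀ k l, pd l (pd k η) x = 0)
    (hv : ∀ x ∉ range a, v x = -curl (weightedPotential F a q) x) (x : T2) :
    integrand η v x = (dbar (dbar fun y => (η y : ℂ)) x *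
      tgrad (weightedPotential F a q) x ^ 2).im / 2 := by
  by_cases hx : x ∈ range a
  · obtain ⟨j, rfl⟩ := hx
    simp [integrand, (hflat j).self_of_nhds,
      dbar_eq_zero_of_eventuallyEq_const (dbar_ofReal_eventuallyEq_const hη (hflat j))]
  · exact integrand_neg_curl_eq_im (hη x) (hv x hx)

lemma integrable_dbar_mul_tgrad_weightedPotential_sq {g : T2 → ℂ} (hF : IsGreen F)
    (hg : ∀ x, SmoothAt 1 g x) (hga : ∀ j, ∀ᶠ x in 𝓝 (a j), g x = g (a j)) :
    Integrable fun x => dbar g x * tgrad (weightedPotential F a q) x ^ 2 :=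
  integrable_dbar_mul_of_eventuallyEq_const hg hga fun _ hx =>
    (smoothAt_tgrad_weightedPotential hF hx).continuousAt.pow 2

lemma integral_dbar_mul_tgrad_weightedPotential_sq [DecidableEq ι] {g : T2 → ℂ} (hF : IsGreen F)
    (ha : Function.Injective a) (hq : ∑ j, q j = 0) (hg : ∀ x, SmoothAt 1 g x)
    (hga : ∀ j, ∀ᶠ x in 𝓝 (a j), g x = g (a j)) :
    ∫ x, dbar g x * tgrad (weightedPotential F a q) x ^ 2 = (-(4 * Real.pi) : ℝ) *
      ∑ i, q i * (g (a i) * ∑ j with j ≠ i, q j * tgrad F (a i - a j)) := by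
  have hsmooth := fun x (hx : x ∉ range a) => smoothAt_tgrad_weightedPotential (q := q) hF hx
  rw [integral_dbar_mul_eq_sum_residue ha hg hga
    (fun x hx => by simpa only [sq] using (hsmooth x hx).mul (hsmooth x hx))
    (fun x hx => dbar_sq_eq_zero (hsmooth x hx) (dbar_tgrad_weightedPotential hF hq hx))
    (hasResidue_tgrad_weightedPotential_sq hF hq ha), Finset.mul_sum, Finset.mul_sum,
    ← Finset.sum_neg_distrib]
  refine Finset.sum_congr rfl fun i _ => ?_
  push_cast
  ring

theorem integrable_integrand_and_integral_eq_sum [DecidableEq ι] (ha : Function.Injective a)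
    (hq : ∑ j, q j = 0) (hF : IsGreen F) (hη : TorusContDiff 2 η)
    (hflat : ∀ j, ∀ᶠ x in 𝓝 (a j), ∀ k l, pd l (pd k η) x = 0)
    (hv : ∀ x ∉ range a, v x = -curl (weightedPotential F a q) x) :
    Integrable (integrand η v) ∧
      ∫ x, integrand η v x = ∑ i, q i * (grad η (a i) ⬝ᵥ
        ((2 * Real.pi) • ∑ j with j ≠ i, q j • curl F (a i - a j))) := by
  set g : T2 → ℂ := dbar fun y => (η y : ℂ)
  set S : ι → ℂ := fun i => ∑ j with j ≠ i, q j * tgrad F (a i - a j)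
  have hη2 : ∀ x, SmoothAt 2 η x := hη.smoothAt
  have hg : ∀ x, SmoothAt 1 g x := fun x => (hη2 x).ofReal.smoothAt_dbar (by norm_num)
  have hga : ∀ j, ∀ᶠ x in 𝓝 (a j), g x = g (a j) := fun j =>
    dbar_ofReal_eventuallyEq_const hη2 (hflat j)
  have hint := integrable_dbar_mul_tgrad_weightedPotential_sq (q := q) hF hg hga
  rw [funext (integrand_eq_im_dbar_mul_tgrad_sq hη2 hflat hv)]
  refine ⟨hint.im.div_const 2, ?_⟩
  calc ∫ x, (dbar g x * tgrad (weightedPotential F a q) x ^ 2).im / 2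
      = (((-(4 * Real.pi) : ℝ) : ℂ) * ∑ i, q i * (g (a i) * S i)).im / 2 := by
        rw [integral_div, ← integral_dbar_mul_tgrad_weightedPotential_sq hF ha hq hg hga]
        exact congrArg (· / 2) (integral_im hint)
    _ = ∑ i, q i * (2 * Real.pi * -(g (a i) * S i).im) := by
        simp only [Complex.im_ofReal_mul, Complex.im_sum, Finset.mul_sum, Finset.sum_div]
        exact Finset.sum_congr rfl fun i _ => by ring
    _ = _ := by
        simp only [dotProduct_smul, smul_eq_mul, S, g,
          grad_dotProduct_sum_smul_curl ((hη2 _).of_le one_le_two)]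

end ResidueFormula

end TorusVortex

end

theorem lemma1_general {ι : Type*} [Fintype ι] [DecidableEq ι] {F : T2 → ℝ} {a : ι → T2}
    {q : ι → ℝ} {η : T2 → ℝ} {v : T2 → Fin 2 → ℝ} (ha : Function.Injective a)
    (hq : ∑ j, q j = 0) (hF : IsGreen F) (i : ι) (hη : TorusContDiff 2 η)
    (hsupp : tsupport η ∩ Set.range a ⊆ {a i})
    (hflat : ∀ᶠ x in 𝓝 (a i), ∀ j l, pd l (pd j η) x = 0)
    (hv : ∀ x ∉ Set.range a, v x = -curl (weightedPotential F a q) x) :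
    Integrable (integrand η v) ∧
      ∫ x, integrand η v x = q i * (grad η (a i) ⬝ᵥ
        ((2 * Real.pi) • ∑ j with j ≠ i, q j • curl F (a i - a j))) := by
  have hzero : ∀ j, j ≠ i → η =ᶠ[𝓝 (a j)] fun _ => 0 := fun j hj =>
    notMem_tsupport_iff_eventuallyEq.1 fun hmem =>
      hj (ha (hsupp ⟨hmem, Set.mem_range_self j⟩))
  have hflat' : ∀ j, ∀ᶠ x in 𝓝 (a j), ∀ k l, pd l (pd k η) x = 0 := fun j => by
    rcases eq_or_ne j i with rfl | hj
    · exact hflat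
    filter_upwards [(hzero j hj).eventuallyEq_nhds] with x hx k l
    refine pd_eq_zero_of_eventuallyEq_const (c := 0) l ?_
    filter_upwards [hx.eventuallyEq_nhds] with y hy
    exact pd_eq_zero_of_eventuallyEq_const k hy
  have hgrad : ∀ j, j ≠ i → grad η (a j) = 0 := fun j hj =>
    funext fun k => pd_eq_zero_of_eventuallyEq_const k (hzero j hj)
  obtain ⟨hint, hsum⟩ := integrable_integrand_and_integral_eq_sum ha hq hF hη hflat' hv
  refine ⟨hint, hsum.trans (Finset.sum_eq_single i (fun j _ hj => ?_) (by simp))⟩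
  rw [hgrad j hj, zero_dotProduct, mul_zero]

theorem lemma1 {m : ℕ} (a : Fin m → T2) (ha : Function.Injective a)
    (d : Fin m → ℤ) (hd : ∑ j, d j = 0)
    (F : T2 → ℝ) (hF : IsGreen F)
    (i : Fin m) (η : T2 → ℝ) (hη : TorusContDiff 2 η)
    (hsupp : tsupport η ∩ Set.range a = {a i})
    (hflat : ∀ᶠ x in 𝓝 (a i), ∀ j l, pd l (pd j η) x = 0) :
    (∀ H : T2 → ℂ, IsCanonicalHarmonicMap F a d H →
      Integrable (integrand η (current H)) ∧
      ∫ x, integrand η (current H) x =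
        (d i : ℝ) * (grad η (a i) ⬝ᵥ
          ((2 * Real.pi) • ∑ j with j ≠ i, (d j : ℝ) • curl F (a i - a j)))) ∧
    (Integrable (integrand η (fun x => - curl (potential F a d) x)) ∧
      ∫ x, integrand η (fun x => - curl (potential F a d) x) x =
        (d i : ℝ) * (grad η (a i) ⬝ᵥ
          ((2 * Real.pi) • ∑ j with j ≠ i, (d j : ℝ) • curl F (a i - a j)))) := by
  have hq : ∑ j, (d j : ℝ) = 0 := mod_cast hd
  exact ⟨fun _ hH => lemma1_general ha hq hF i hη hsupp.subset hflat hH.current_eq,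
    lemma1_general ha hq hF i hη hsupp.subset hflat fun _ _ => rfl⟩
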